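/- For a finite nonempty binary word $w$ let $\mathrm{per}(w)$ be its smallest period $p\ge 1$ and let $\exp(w)=|w|/\mathrm{per}(w)$ be its exponent. An infinite word is $\beta$-free (resp. $\beta^+$-free) if all its nonempty finite factors have exponent $<\beta$ (resp. $\le\beta$); its critical exponent is the supremum, possibly $+\infty$, of the exponents of its nonempty finite factors. An antisquare of order $k\ge 1$ is a binary word $y\,\overline{y}$ with $|y|=k$, where $\overline{y}$ is obtained from $y$ by exchanging the letters $0$ and $1$. Let $\alpha=(1+\sqrt5)/2$. Theorem. For each of the pairs $$(\ell,\beta)\in\{(2,\,2+\alpha),\ (3,\,8/3),\ (5,\,5/2),\ (6,\,7/3)\}$$ there exists an infinite $\beta^+$-free binary word that contains no antisquare of order $\ge\ell$. These pairs are all optimal: for each of them, every infinite binary word that contains no antisquare of order $\ge\ell$ has critical exponent at least $\beta$, and for every integer $0\le\ell'<\ell$ there is no infinite $\beta^+$-free binary word that contains no antisquare of order $\ge\ell'$. Moreover, for the three pairs $(3,8/3)$, $(5,5/2)$, $(6,7/3)$, no infinite binary word that contains no antisquare of order $\ge\ell$ is $\beta$-free. -/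

import Mathlib

/-- `u` is a factor (a finite block of consecutive letters) of the right-infinite word `w`. -/
def IsFactor {A : Type*} (u : List A) (w : ℕ → A) : Prop :=
  ∃ i n : ℕ, u = (List.range n).map (fun j => w (i + j))

/-- The (smallest) period of a finite word: the least `p ≥ 1` such that `u[i] = u[i + p]`
whenever both letters exist. The set is nonempty, since it contains every `p ≥ max 1 |u|`. -/
noncomputable def period {A : Type*} (u : List A) : ℕ :=
  sInf {p : ℕ | 1 ≤ p ∧ u.HasPeriod p}

/-- The exponent of a finite word: its length divided by its period. -/
noncomputable def exponent {A : Type*} (u : List A) : ℝ :=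
  (u.length : ℝ) / (period u : ℝ)

/-- `w` is `β`-free: every nonempty factor has exponent `< β`. -/
def IsFree {A : Type*} (β : ℝ) (w : ℕ → A) : Prop :=
  ∀ u : List A, u ≠ [] → IsFactor u w → exponent u < β

/-- `w` is `β⁺`-free: every nonempty factor has exponent `≤ β`. -/
def IsPlusFree {A : Type*} (β : ℝ) (w : ℕ → A) : Prop :=
  ∀ u : List A, u ≠ [] → IsFactor u w → exponent u ≤ β

/-- The critical exponent of `w`: the supremum, in the extended reals, of the exponents of its
nonempty factors. -/
noncomputable def criticalExponent {A : Type*} (w : ℕ → A) : EReal :=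
  sSup {e : EReal | ∃ u : List A, u ≠ [] ∧ IsFactor u w ∧ e = ((exponent u : ℝ) : EReal)}

/-- The complement of a binary word (`false` is the letter 0, `true` is the letter 1). -/
def complement (y : List Bool) : List Bool := y.map not

/-- `x` is an antisquare of order `k`: a nonempty word `y ȳ` with `|y| = k`. -/
def IsAntisquareOfOrder (x : List Bool) (k : ℕ) : Prop :=
  x ≠ [] ∧ ∃ y : List Bool, y.length = k ∧ x = y ++ complement y

/-- The infinite binary words that contain no antisquare of order at least `l`. -/
def AO (l : ℕ) : Set (ℕ → Bool) :=
  {w | ∀ (x : List Bool) (k : ℕ), l ≤ k → IsAntisquareOfOrder x k → ¬ IsFactor x w}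

/-!
Everything is phrased through *matches*: `Match c w i p r` says that on a window of `r` positions
the letters of `w` at distance `p` agree (a repetition of period `p` and length `p + r`) or differ
(for `r = p`, an antisquare of order `p`).

**Existence for `(3, 8/3)`, `(5, 5/2)`, `(6, 7/3)`.** The words are images of the Thue–Morse word
under uniform morphisms. A long match in such an image contains the whole image of a letter. As the
complement of this image occurs nowhere, there are no long antisquares; as the image occurs only
where it should, the period of a long repetition is a multiple of the block length. Since the
exponents in question exceed `2` by a margin that covers the common prefix and suffix of the two
images, such a repetition comes from an overlap in the Thue–Morse word, which has none
(`thueMorse_overlapFree`). The short matches lie inside images of five letters, and are excluded by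
a finite check (`IsGoodMorphism`).

**Existence for `(2, 2 + φ)`.** The word is `0 v₀ 0 v₁ 0 v₂ ⋯` with the Fibonacci word `v`, given as
the word of increments of `⌊i / φ⌋`. Parity excludes antisquares of order at least `2`. The
length of a repetition of period `p` in `v` is bounded by the time until the rotation by `1 / φ`
visits an interval of length `|p / φ - D|` at `0`. Best approximation bounds this length from below
by a power of `1 / φ` (`le_abs_mul_invPhi_sub`), and the return times to an interval of such a length
are Fibonacci numbers (`Visits.exists_sub`).

**Optimality.** All but one of the negative claims are finite: a backtracking search (`search`),
evaluated by the kernel, shows that no long word avoids suitable antisquares and repetitions. The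
exception is that a word with no antisquare of order at least `2` has critical exponent at least
`2 + φ` (`not_isFree_of_lt`). If all exponents are below some `γ < 2 + φ`, then a finite search shows
that, from some point on, every second letter is the same; the other letters form a word `v` with
no two consecutive letters of the one kind and no three of the other. Such a word factors into the
Fibonacci words `1` and `10`, and inductively, from some point on, into the `n`-th and `(n + 1)`-st
finite Fibonacci words, for every `n`: a square of the shorter one would give an exponent above `γ`,
because all continuations share a long prefix (`Parses.no_square`, `Parses.succ`). At level `n + 1`
the shorter of the two blocks is the start of a repetition whose exponent tends to `2 + φ`
(`Parses.lt`).
-/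

/-! ### Matches and their relation to exponents and antisquares -/

/-- For `r` consecutive positions `j`, starting at `i`, the letters of `w` at `j` and `j + p` agree
(`c = false`) or differ (`c = true`). With `c = false` this says that the factor of length `p + r`
at `i` has period `p`; with `c = true` and `r = p` it is an antisquare of order `p`. -/
def Match (c : Bool) (w : ℕ → Bool) (i p r : ℕ) : Prop :=
  ∀ j < r, (w (i + j) ^^ w (i + j + p)) = c

theorem Match.mono {c : Bool} {w : ℕ → Bool} {i p r r' : ℕ} (h : Match c w i p r) (hr : r' ≤ r) :
    Match c w i p r' :=
  fun j hj => h j (hj.trans_le hr)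

theorem match_false_iff {w : ℕ → Bool} {i p r : ℕ} :
    Match false w i p r ↔ ∀ j < r, w (i + j) = w (i + j + p) := by
  simp [Match]

theorem match_true_iff {w : ℕ → Bool} {i p r : ℕ} :
    Match true w i p r ↔ ∀ j < r, w (i + j + p) = !w (i + j) := by
  unfold Match
  refine forall₂_congr fun j _ => ?_
  cases w (i + j) <;> cases w (i + j + p) <;> simp

theorem hasPeriod_factor_iff {w : ℕ → Bool} {i p n : ℕ} :
    ((List.range n).map (fun j => w (i + j))).HasPeriod p ↔ Match false w i p (n - p) := by
  rw [List.hasPeriod_iff_getElem?, match_false_iff]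
  simp only [List.length_map, List.length_range]
  refine forall₂_congr fun j hj => ?_
  rw [List.getElem?_map, List.getElem?_map, List.getElem?_range (by omega),
    List.getElem?_range (by omega)]
  simp [add_assoc]

theorem period_mem {A : Type*} (u : List A) : 1 ≤ period u ∧ u.HasPeriod (period u) :=
  Nat.sInf_mem (s := {p : ℕ | 1 ≤ p ∧ u.HasPeriod p})
    ⟨u.length + 1, by simp, List.hasPeriod_of_length_le _ _ (by simp)⟩

theorem Match.le_exponent {w : ℕ → Bool} {i p r : ℕ} (hp : 1 ≤ p) (h : Match false w i p r) :
    ((p + r : ℕ) : ℝ) / p ≤ exponent ((List.range (p + r)).map (fun j => w (i + j))) := by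
  set u := (List.range (p + r)).map (fun j => w (i + j)) with hu
  have hle : period u ≤ p := Nat.sInf_le
    (s := {p : ℕ | 1 ≤ p ∧ u.HasPeriod p}) ⟨hp, hasPeriod_factor_iff.2 (by simpa using h)⟩
  have h1 := (period_mem u).1
  unfold exponent
  have : u.length = p + r := by simp [hu]
  rw [this]
  have : (0 : ℝ) < period u := by exact_mod_cast h1
  gcongr

theorem factor_ne_nil {w : ℕ → Bool} {i n : ℕ} (hn : 1 ≤ n) :
    (List.range n).map (fun j => w (i + j)) ≠ [] := by
  intro h
  have := congrArg List.length h
  simp at this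
  omega

theorem IsFree.lt_of_match {β : ℝ} {w : ℕ → Bool} (hw : IsFree β w) {i p r : ℕ} (hp : 1 ≤ p)
    (h : Match false w i p r) : (p + r : ℝ) < β * p := by
  have h1 := (h.le_exponent hp).trans_lt (hw _ (factor_ne_nil (by omega)) ⟨i, p + r, rfl⟩)
  rw [div_lt_iff₀ (by exact_mod_cast hp)] at h1
  exact_mod_cast h1

theorem IsPlusFree.le_of_match {β : ℝ} {w : ℕ → Bool} (hw : IsPlusFree β w) {i p r : ℕ}
    (hp : 1 ≤ p) (h : Match false w i p r) : (p + r : ℝ) ≤ β * p := by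
  have h1 := (h.le_exponent hp).trans (hw _ (factor_ne_nil (by omega)) ⟨i, p + r, rfl⟩)
  rw [div_le_iff₀ (by exact_mod_cast hp)] at h1
  exact_mod_cast h1

theorem isPlusFree_of_match {β : ℝ} (hβ : 1 ≤ β) {w : ℕ → Bool}
    (h : ∀ i p r : ℕ, 1 ≤ p → Match false w i p r → (p + r : ℝ) ≤ β * p) : IsPlusFree β w := by
  rintro u - ⟨i, n, hu⟩
  obtain ⟨h1, h2⟩ := period_mem u
  have hlen : u.length = n := by simp [hu]
  have hpos : (0 : ℝ) < period u := by exact_mod_cast h1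
  rw [exponent, hlen, div_le_iff₀ hpos]
  rcases le_total n (period u) with hn | hn
  · have : (n : ℝ) ≤ period u := by exact_mod_cast hn
    nlinarith
  · have h3 : Match false w i (period u) (n - period u) := by
      rw [← hasPeriod_factor_iff, ← hu]
      exact h2
    have := h i _ _ h1 h3
    rw [Nat.cast_sub hn] at this
    linarith

theorem mem_AO_iff {l : ℕ} {w : ℕ → Bool} :
    w ∈ AO l ↔ ∀ k, l ≤ k → 1 ≤ k → ∀ i, ¬ Match true w i k k := by
  constructor
  · intro hw k hk hk1 i h
    refine hw _ k hk ⟨factor_ne_nil (w := w) (i := i) (n := k + k) (by omega),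
      (List.range k).map (fun j => w (i + j)), by simp, ?_⟩ ⟨i, k + k, rfl⟩
    rw [List.range_add, List.map_append, complement, List.map_map, List.map_map]
    congr 1
    refine List.map_congr_left fun j hj => ?_
    have := match_true_iff.1 h j (List.mem_range.1 hj)
    simp only [Function.comp_apply]
    rw [← this]
    congr 1
    omega
  · rintro hw x k hk ⟨hx, y, hy, hxy⟩ ⟨i, n, hu⟩
    have hn : n = k + k := by
      have h1 := congrArg List.length hu
      have h2 := congrArg List.length hxy
      simp [complement] at h1 h2
      omega
    have hk1 : 1 ≤ k := by
      by_contra h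
      obtain rfl : k = 0 := by omega
      subst hn
      simp at hu
      exact hx hu
    refine hw k hk hk1 i (match_true_iff.2 fun j hj => ?_)
    have e : ∀ m < k + k, (y ++ complement y)[m]? = some (w (i + m)) := by
      intro m hm
      rw [← hxy, hu, hn, List.getElem?_map, List.getElem?_range hm]
      rfl
    have e1 := e j (by omega)
    have e2 := e (j + k) (by omega)
    rw [List.getElem?_append_left (by omega)] at e1
    rw [List.getElem?_append_right (by omega), hy, Nat.add_sub_cancel, complement,
      List.getElem?_map, e1] at e2
    simp only [Option.map_some, Option.some.injEq] at e2
    rw [add_assoc, e2]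

/-- A word that is not `β`-free has critical exponent at least `β`. -/
theorem le_criticalExponent_of_not_isFree {β : ℝ} {w : ℕ → Bool} (h : ¬ IsFree β w) :
    (β : EReal) ≤ criticalExponent w := by
  unfold IsFree at h
  push Not at h
  obtain ⟨u, hu, hf, hle⟩ := h
  exact (EReal.coe_le_coe_iff.2 hle).trans (le_sSup ⟨u, hu, hf, rfl⟩)

theorem isFree_of_criticalExponent_lt {β : ℝ} {w : ℕ → Bool} (h : criticalExponent w < β) :
    IsFree β w := by
  intro u hu hf
  have h1 : ((exponent u : ℝ) : EReal) ≤ criticalExponent w := le_sSup ⟨u, hu, hf, rfl⟩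
  exact EReal.coe_lt_coe_iff.1 (h1.trans_lt h)

/-! ### Refutation by backtracking -/

/-- The words `u` and `v` both have at least `r` letters, and their first `r` letters agree in every
place (`c = false`) or differ in every place (`c = true`). -/
def agree (c : Bool) : ℕ → List Bool → List Bool → Bool
  | 0, _, _ => true
  | r + 1, a :: u, b :: v => match a, b, c with
    | true, true, false => agree c r u v
    | false, false, false => agree c r u v
    | true, false, true => agree c r u v
    | false, true, true => agree c r u v
    | _, _, _ => false
  | _ + 1, _, _ => false

/-- The list `u` is the block of letters of `w` that starts at position `i`. -/
def IsBlock (w : ℕ → Bool) (i : ℕ) (u : List Bool) : Prop :=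
  ∀ j a, u[j]? = some a → w (i + j) = a

theorem isBlock_cons {w : ℕ → Bool} {i : ℕ} {a : Bool} {u : List Bool} :
    IsBlock w i (a :: u) ↔ w i = a ∧ IsBlock w (i + 1) u := by
  constructor
  · intro h
    refine ⟨h 0 a rfl, fun j b hj => ?_⟩
    have := h (j + 1) b (by simpa using hj)
    rwa [← add_assoc, add_right_comm] at this
  · rintro ⟨h0, h⟩ (_ | j) b hj
    · simp at hj
      rw [add_zero, h0, hj]
    · have := h j b (by simpa using hj)
      rwa [← add_assoc, add_right_comm]

theorem isBlock_nil (w : ℕ → Bool) (i : ℕ) : IsBlock w i [] := by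
  intro j a h
  simp at h

theorem IsBlock.drop {w : ℕ → Bool} {i : ℕ} {u : List Bool} (h : IsBlock w i u) (p : ℕ) :
    IsBlock w (i + p) (u.drop p) := by
  intro j a hj
  rw [List.getElem?_drop] at hj
  rw [add_assoc]
  exact h _ _ hj

theorem isBlock_append {w : ℕ → Bool} {i : ℕ} {u v : List Bool} :
    IsBlock w i (u ++ v) ↔ IsBlock w i u ∧ IsBlock w (i + u.length) v := by
  induction u generalizing i with
  | nil => simp [isBlock_nil]
  | cons a u ih =>
    rw [List.cons_append, isBlock_cons, isBlock_cons, ih, and_assoc, List.length_cons,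
      add_assoc, add_comm 1]

theorem agree_eq_true {c : Bool} {w : ℕ → Bool} {r : ℕ} {i k : ℕ} {u v : List Bool}
    (hu : IsBlock w i u) (hv : IsBlock w k v) (h : agree c r u v = true) :
    ∀ j < r, (w (i + j) ^^ w (k + j)) = c := by
  induction r generalizing i k u v with
  | zero => simp
  | succ r ih =>
    match u, v, h with
    | a :: u, b :: v, h =>
      rw [isBlock_cons] at hu hv
      have h' : (a ^^ b) = c ∧ agree c r u v = true := by
        cases a <;> cases b <;> cases c <;> simp_all [agree]
      rintro (_ | j) hj
      · rw [add_zero, add_zero, hu.1, hv.1]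
        exact h'.1
      · have := ih hu.2 hv.2 h'.2 j (by omega)
        rwa [add_right_comm, add_right_comm k, add_assoc, add_assoc] at this
    | [], _, h => simp [agree] at h
    | _ :: _, [], h => simp [agree] at h

theorem agree_of_match {c : Bool} {w : ℕ → Bool} {r : ℕ} {i k : ℕ} {u v : List Bool}
    (hu : IsBlock w i u) (hv : IsBlock w k v) (hur : r ≤ u.length) (hvr : r ≤ v.length)
    (h : ∀ j < r, (w (i + j) ^^ w (k + j)) = c) : agree c r u v = true := by
  induction r generalizing i k u v with
  | zero => simp [agree]
  | succ r ih =>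
    match u, v with
    | a :: u, b :: v =>
      rw [isBlock_cons] at hu hv
      have h0 := h 0 (by omega)
      rw [add_zero, add_zero, hu.1, hv.1] at h0
      have := ih hu.2 hv.2 (by simpa using hur) (by simpa using hvr) (fun j hj => by
        have := h (j + 1) (by omega)
        rwa [← add_assoc, ← add_assoc, add_right_comm, add_right_comm k] at this)
      cases a <;> cases b <;> cases c <;> simp_all [agree]
    | [], _ => simp at hur
    | _ :: _, [] => simp at hvr

/-- A triple `(c, p, r)` stands for the pattern `Match c w i p r`; this tests for an occurrence at
the start of `u`. -/
def hit (u : List Bool) (t : Bool × ℕ × ℕ) : Bool :=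
  agree t.1 t.2.2 u (u.drop t.2.1)

/-- None of the patterns in `T` occurs in `w`. -/
def Avoids (w : ℕ → Bool) (T : List (Bool × ℕ × ℕ)) : Prop :=
  ∀ t ∈ T, ∀ i, ¬ Match t.1 w i t.2.1 t.2.2

/-- Backtracking: every extension of `u` by `n` letters to the left either meets a pattern of `T`
at one of its stages, or satisfies `leaf` at the last one. -/
def search (T : List (Bool × ℕ × ℕ)) (leaf : List Bool → Bool) : ℕ → List Bool → Bool
  | 0, u => T.any (hit u) || leaf u
  | n + 1, u => T.any (hit u) || (search T leaf n (true :: u) && search T leaf n (false :: u))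

theorem Avoids.any_hit {w : ℕ → Bool} {T : List (Bool × ℕ × ℕ)} (hw : Avoids w T) {i : ℕ}
    {u : List Bool} (hu : IsBlock w i u) : T.any (hit u) = false := by
  rw [List.any_eq_false]
  intro t ht h
  refine hw t ht i fun j hj => ?_
  have := agree_eq_true hu (hu.drop t.2.1) h j hj
  rwa [add_right_comm] at this

theorem Avoids.of_search {w : ℕ → Bool} {T : List (Bool × ℕ × ℕ)} (hw : Avoids w T)
    {leaf : List Bool → Bool} {n i : ℕ} {u : List Bool} (h : search T leaf n u = true)
    (hu : IsBlock w (i + n) u) :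
    ∃ v, v.length = u.length + n ∧ IsBlock w i v ∧ leaf v = true := by
  induction n generalizing u with
  | zero =>
    rw [search, hw.any_hit hu, Bool.false_or] at h
    exact ⟨u, by simp, hu, h⟩
  | succ n ih =>
    rw [search, hw.any_hit hu, Bool.false_or, Bool.and_eq_true] at h
    have h' : search T leaf n (w (i + n) :: u) = true := by
      cases w (i + n)
      exacts [h.2, h.1]
    obtain ⟨v, hv, h2⟩ := ih h' (isBlock_cons.2 ⟨rfl, by rwa [add_assoc]⟩)
    exact ⟨v, by simp at hv; omega, h2⟩

theorem not_avoids_of_search {w : ℕ → Bool} {T : List (Bool × ℕ × ℕ)} {n : ℕ}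
    (h : search T (fun _ => false) n [] = true) : ¬ Avoids w T := by
  intro hw
  obtain ⟨v, -, -, hv⟩ := hw.of_search (i := 0) h (isBlock_nil _ _)
  simp at hv

/-- Each pattern in `T` is an antisquare of order at least `l`, or a repetition of exponent at
least `a / b`. -/
def patternsFree (l a b : ℕ) (T : List (Bool × ℕ × ℕ)) : Bool :=
  T.all fun t => decide (1 ≤ t.2.1) &&
    (if t.1 then decide (l ≤ t.2.1) && decide (t.2.2 = t.2.1)
      else decide (a * t.2.1 ≤ b * (t.2.1 + t.2.2)))

/-- Each pattern in `T` is an antisquare of order at least `l`, or a repetition of exponent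
greater than `a / b`. -/
def patternsPlusFree (l a b : ℕ) (T : List (Bool × ℕ × ℕ)) : Bool :=
  T.all fun t => decide (1 ≤ t.2.1) &&
    (if t.1 then decide (l ≤ t.2.1) && decide (t.2.2 = t.2.1)
      else decide (a * t.2.1 < b * (t.2.1 + t.2.2)))

theorem IsFree.avoids {β : ℝ} {l a b : ℕ} {w : ℕ → Bool} (hw : IsFree β w) (hl : w ∈ AO l)
    (hb : 0 < b) (hβ : β ≤ a / b) {T : List (Bool × ℕ × ℕ)} (hT : patternsFree l a b T = true) :
    Avoids w T := by
  rintro ⟨c, p, r⟩ ht i h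
  have h1 := List.all_eq_true.1 hT _ ht
  simp only [Bool.and_eq_true, decide_eq_true_eq] at h h1
  obtain ⟨hp, h1⟩ := h1
  have hb' : (0 : ℝ) < b := by exact_mod_cast hb
  cases c
  · simp only [Bool.false_eq_true, if_false, decide_eq_true_eq] at h1
    have h2 := hw.lt_of_match hp h
    have h3 : (a : ℝ) * p ≤ b * (p + r) := by exact_mod_cast h1
    have hp' : (0 : ℝ) < p := by exact_mod_cast hp
    rw [le_div_iff₀ hb'] at hβ
    nlinarith
  · simp only [if_true, Bool.and_eq_true, decide_eq_true_eq] at h1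
    obtain ⟨h2, rfl⟩ := h1
    exact mem_AO_iff.1 hl _ h2 hp i h

theorem IsPlusFree.avoids {β : ℝ} {l a b : ℕ} {w : ℕ → Bool} (hw : IsPlusFree β w) (hl : w ∈ AO l)
    (hb : 0 < b) (hβ : β ≤ a / b) {T : List (Bool × ℕ × ℕ)}
    (hT : patternsPlusFree l a b T = true) : Avoids w T := by
  rintro ⟨c, p, r⟩ ht i h
  have h1 := List.all_eq_true.1 hT _ ht
  simp only [Bool.and_eq_true, decide_eq_true_eq] at h h1
  obtain ⟨hp, h1⟩ := h1
  have hb' : (0 : ℝ) < b := by exact_mod_cast hb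
  cases c
  · simp only [Bool.false_eq_true, if_false, decide_eq_true_eq] at h1
    have h2 := hw.le_of_match hp h
    have h3 : (a : ℝ) * p < b * (p + r) := by exact_mod_cast h1
    have hp' : (0 : ℝ) < p := by exact_mod_cast hp
    rw [le_div_iff₀ hb'] at hβ
    nlinarith
  · simp only [if_true, Bool.and_eq_true, decide_eq_true_eq] at h1
    obtain ⟨h2, rfl⟩ := h1
    exact mem_AO_iff.1 hl _ h2 hp i h

theorem AO_mono {l l' : ℕ} (h : l ≤ l') : AO l ⊆ AO l' :=
  fun _ hw x k hk => hw x k (h.trans hk)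

/-! ### The Thue–Morse word -/

/-- The Thue–Morse word: the `n`-th letter is the parity of the binary digit sum of `n`. -/
def thueMorse (n : ℕ) : Bool :=
  (Nat.digits 2 n).sum.bodd

theorem thueMorse_two_mul (n : ℕ) : thueMorse (2 * n) = thueMorse n := by
  rcases Nat.eq_zero_or_pos n with rfl | hn
  · rfl
  · have := Nat.digits_base_mul (b := 2) (m := n) (by norm_num) hn
    simp [thueMorse, this]

theorem thueMorse_two_mul_add_one (n : ℕ) : thueMorse (2 * n + 1) = !thueMorse n := by
  have := Nat.digits_add_two_add_one 0 (2 * n)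
  simp only [thueMorse]
  rw [show (2 : ℕ) = 0 + 2 from rfl, this]
  have e : (2 * n + 1) / 2 = n := by omega
  simp [e, Nat.add_mod]

theorem thueMorse_two_mul_ne (n : ℕ) : thueMorse (2 * n) ≠ thueMorse (2 * n + 1) := by
  rw [thueMorse_two_mul, thueMorse_two_mul_add_one]
  simp

/-- Two equal consecutive letters of the Thue–Morse word start at an odd position. -/
theorem odd_of_thueMorse_eq {n : ℕ} (h : thueMorse n = thueMorse (n + 1)) : n % 2 = 1 := by
  by_contra hn
  obtain ⟨m, rfl⟩ : ∃ m, n = 2 * m := ⟨n / 2, by omega⟩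
  exact thueMorse_two_mul_ne m h

theorem thueMorse_no_cube_letter (n : ℕ) (h1 : thueMorse n = thueMorse (n + 1))
    (h2 : thueMorse (n + 1) = thueMorse (n + 2)) : False := by
  have := odd_of_thueMorse_eq h1
  have := odd_of_thueMorse_eq h2
  omega

theorem thueMorse_succ_of_ne {m : ℕ} (h : thueMorse (2 * m + 1) ≠ thueMorse (2 * m + 2)) :
    thueMorse m = thueMorse (m + 1) := by
  rw [thueMorse_two_mul_add_one, show 2 * m + 2 = 2 * (m + 1) by ring, thueMorse_two_mul] at h
  cases h1 : thueMorse m <;> cases h2 : thueMorse (m + 1) <;> simp_all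

/-- The Thue–Morse word does not contain `01010` or `10101`. -/
theorem thueMorse_no_alternating (n : ℕ)
    (h : ∀ j < 4, thueMorse (n + j) ≠ thueMorse (n + j + 1)) : False := by
  obtain ⟨m, hm⟩ : ∃ m, n = 2 * m ∨ n = 2 * m + 1 := ⟨n / 2, by omega⟩
  have key : ∀ m, thueMorse (2 * m + 1) ≠ thueMorse (2 * m + 2) →
      thueMorse (2 * (m + 1) + 1) ≠ thueMorse (2 * (m + 1) + 2) → False := fun m h1 h2 =>
    thueMorse_no_cube_letter m (thueMorse_succ_of_ne h1) (thueMorse_succ_of_ne h2)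
  rcases hm with rfl | rfl
  · exact key m (h 1 (by norm_num)) (h 3 (by norm_num))
  · exact key m (h 0 (by norm_num)) (h 2 (by norm_num))

/-- The Thue–Morse word is overlap-free. An overlap of even period gives one of half the period;
in an overlap of odd period `p`, no two consecutive letters can be equal, because they would recur
`p` places later, at a position of the other parity. -/
theorem thueMorse_overlapFree {p : ℕ} (hp : 1 ≤ p) (a : ℕ)
    (h : ∀ j ≤ p, thueMorse (a + j) = thueMorse (a + j + p)) : False := by
  induction p using Nat.strong_induction_on generalizing a with
  | _ p ih =>
    obtain ⟨k, hk | hk⟩ : ∃ k, p = 2 * k ∨ p = 2 * k + 1 := ⟨p / 2, by omega⟩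
    · refine ih k (by omega) (by omega) (a / 2) fun j hj => ?_
      have h1 := h (2 * j) (by omega)
      obtain ⟨m, rfl | rfl⟩ : ∃ m, a = 2 * m ∨ a = 2 * m + 1 := ⟨a / 2, by omega⟩
      · rw [show 2 * m + 2 * j + p = 2 * (m + j + k) by omega,
          show 2 * m + 2 * j = 2 * (m + j) by ring, thueMorse_two_mul, thueMorse_two_mul] at h1
        rwa [show 2 * m / 2 = m by omega]
      · rw [show 2 * m + 1 + 2 * j + p = 2 * (m + j + k) + 1 by omega,
          show 2 * m + 1 + 2 * j = 2 * (m + j) + 1 by ring, thueMorse_two_mul_add_one,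
          thueMorse_two_mul_add_one] at h1
        rw [show (2 * m + 1) / 2 = m by omega]
        simpa using h1
    · have alt : ∀ j < p, thueMorse (a + j) ≠ thueMorse (a + j + 1) := by
        intro j hj e
        have e' : thueMorse (a + j + p) = thueMorse (a + j + p + 1) := by
          rw [← h j hj.le, e, add_assoc a, h (j + 1) (by omega)]
          congr 1
          omega
        have := odd_of_thueMorse_eq e
        have := odd_of_thueMorse_eq e'
        omega
      have : k = 0 ∨ k = 1 ∨ 2 ≤ k := by omega
      rcases this with rfl | rfl | hk2
      · subst hk
        exact alt 0 (by norm_num) (h 0 (by norm_num))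
      · subst hk
        have h0 := alt 0 (by norm_num)
        have h1 := alt 1 (by norm_num)
        have h2 := alt 2 (by norm_num)
        have h3 := h 0 (by norm_num)
        norm_num [add_assoc] at h0 h1 h2 h3
        cases h4 : thueMorse a <;> cases h5 : thueMorse (a + 1) <;>
          cases h6 : thueMorse (a + 2) <;> simp_all
      · exact thueMorse_no_alternating a fun j hj => alt j (by omega)

/-! ### Uniform images of the Thue–Morse word -/

/-- The image of the Thue–Morse word under the morphism that sends the letter `c` to the word `B c`
of length `q`. -/
def morphicImage (B : Bool → List Bool) (q n : ℕ) : Bool :=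
  (B (thueMorse (n / q))).getD (n % q) false

/-- The word of five letters `c₀, …, c₄` does not contain the overlaps `000`, `111`, `01010`,
`10101`. -/
def overlapFreeFive (c₀ c₁ c₂ c₃ c₄ : Bool) : Bool :=
  !(c₀ == c₁ && c₁ == c₂) && !(c₁ == c₂ && c₂ == c₃) && !(c₂ == c₃ && c₃ == c₄) &&
    !(c₀ != c₁ && c₁ != c₂ && c₂ != c₃ && c₃ != c₄)

theorem overlapFreeFive_thueMorse (m : ℕ) :
    overlapFreeFive (thueMorse m) (thueMorse (m + 1)) (thueMorse (m + 2)) (thueMorse (m + 3))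
      (thueMorse (m + 4)) = true := by
  have h0 := thueMorse_no_cube_letter m
  have h1 := thueMorse_no_cube_letter (m + 1)
  have h2 := thueMorse_no_cube_letter (m + 2)
  have h3 : ¬ (thueMorse m ≠ thueMorse (m + 1) ∧ thueMorse (m + 1) ≠ thueMorse (m + 2) ∧
      thueMorse (m + 2) ≠ thueMorse (m + 3) ∧ thueMorse (m + 3) ≠ thueMorse (m + 4)) := by
    rintro ⟨a, b, c, d⟩
    refine thueMorse_no_alternating m fun j hj => ?_
    interval_cases j <;> assumption
  simp only [add_assoc] at h0 h1 h2 h3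
  norm_num at h0 h1 h2 h3
  generalize thueMorse m = c₀ at *
  generalize thueMorse (m + 1) = c₁ at *
  generalize thueMorse (m + 2) = c₂ at *
  generalize thueMorse (m + 3) = c₃ at *
  generalize thueMorse (m + 4) = c₄ at *
  revert h0 h1 h2 h3
  revert c₀ c₁ c₂ c₃ c₄
  decide

/-- For each shift `p` with `N - n < p ≤ N`, the word `u` does not start with a repetition of
period `p` and exponent greater than `a / b`, nor, if `l ≤ p`, with an antisquare of order `p`.
The argument `v` is the suffix of `u` that starts at the place `N + 1 - n`. -/
def noRepetition (l a b N : ℕ) (u : List Bool) : ℕ → List Bool → Bool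
  | 0, _ => true
  | n + 1, v => !agree false ((a - b) * (N - n) / b + 1) u v &&
      (!Nat.ble l (N - n) || !agree true (N - n) u v) && noRepetition l a b N u n v.tail

/-- `noRepetition` for each of the first `m` suffixes of a word and all shifts from `1` to `N`. -/
def noRepetitions (l a b N : ℕ) : ℕ → List Bool → Bool
  | 0, _ => true
  | m + 1, u => noRepetition l a b N u N u.tail && noRepetitions l a b N m u.tail

theorem noRepetition_apply {l a b N : ℕ} {u : List Bool} {n : ℕ} (hn : n ≤ N)
    (h : noRepetition l a b N u n (u.drop (N + 1 - n)) = true) {p : ℕ} (hp : N - n < p)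
    (hpN : p ≤ N) :
    agree false ((a - b) * p / b + 1) u (u.drop p) = false ∧
      (l ≤ p → agree true p u (u.drop p) = false) := by
  induction n with
  | zero => omega
  | succ n ih =>
    rw [show N + 1 - (n + 1) = N - n by omega] at h
    simp only [noRepetition, Bool.and_eq_true, Bool.or_eq_true, Bool.not_eq_true'] at h
    obtain ⟨⟨h1, h2⟩, h3⟩ := h
    rcases (show p = N - n ∨ N - n < p by omega) with rfl | hlt
    · refine ⟨h1, fun hl => h2.resolve_left ?_⟩
      simpa using hl
    · refine ih (by omega) ?_ hlt
      rwa [List.tail_drop, show N - n + 1 = N + 1 - n by omega] at h3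

theorem noRepetitions_apply {l a b N m : ℕ} {u : List Bool}
    (h : noRepetitions l a b N m u = true) {o p : ℕ} (ho : o < m) (hp : 1 ≤ p) (hpN : p ≤ N) :
    agree false ((a - b) * p / b + 1) (u.drop o) ((u.drop o).drop p) = false ∧
      (l ≤ p → agree true p (u.drop o) ((u.drop o).drop p) = false) := by
  induction m generalizing u o with
  | zero => omega
  | succ m ih =>
    simp only [noRepetitions, Bool.and_eq_true] at h
    rcases o with _ | o
    · rw [List.drop_zero]
      refine noRepetition_apply le_rfl ?_ (by omega) hpN
      simpa using h.1
    · have := ih h.2 (o := o) (by omega)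
      simpa using this

/-- Finitely many conditions on a `q`-uniform binary morphism `B` under which the image of the
Thue–Morse word contains no antisquare of order at least `l` and no repetition of exponent greater
than `a / b`. -/
structure IsGoodMorphism (l a b q : ℕ) (B : Bool → List Bool) (d₁ d₂ : ℕ) : Prop where
  b_pos : 0 < b
  two_mul_le : 2 * b ≤ a
  length_eq : ∀ c, (B c).length = q
  /-- An image of a letter occurs within an image of two letters only as a prefix or suffix. -/
  sync : ∀ c d e, ∀ o < q, 0 < o → agree false q (B c) ((B d ++ B e).drop o) = false
  /-- The complement of an image of a letter does not occur within an image of two letters. -/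
  anti : ∀ c d e, ∀ o < q, agree true q (B c) ((B d ++ B e).drop o) = false
  lt_q : d₁ < q ∧ d₂ < q
  /-- The two images differ at the places `d₁` and `d₂`. -/
  ne₁ : (B false)[d₁]? ≠ (B true)[d₁]?
  ne₂ : (B false)[d₂]? ≠ (B true)[d₂]?
  /-- The images agree before `d₁` and after `d₂` in few enough places, if `d₁` and `d₂` are the
  extreme places of disagreement. -/
  extension : b * (q + d₁) + 2 * b * q ≤ a * q + b * (d₂ + 1)
  /-- Repetitions and antisquares of small period within an image of five letters. -/
  short : ∀ c₀ c₁ c₂ c₃ c₄, overlapFreeFive c₀ c₁ c₂ c₃ c₄ = true →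
    noRepetitions l a b (2 * q - 2) q (B c₀ ++ (B c₁ ++ (B c₂ ++ (B c₃ ++ B c₄)))) = true

namespace IsGoodMorphism

variable {l a b q : ℕ} {B : Bool → List Bool} {d₁ d₂ : ℕ}

theorem q_pos (hB : IsGoodMorphism l a b q B d₁ d₂) : 0 < q := by
  have := hB.lt_q
  omega

theorem isBlock (hB : IsGoodMorphism l a b q B d₁ d₂) (m : ℕ) :
    IsBlock (morphicImage B q) (q * m) (B (thueMorse m)) := by
  intro j c hj
  have hjq : j < q := by
    rw [← hB.length_eq (thueMorse m)]
    exact (List.getElem?_eq_some_iff.1 hj).1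
  rw [morphicImage, Nat.mul_add_div hB.q_pos, Nat.mul_add_mod, Nat.div_eq_of_lt hjq,
    Nat.mod_eq_of_lt hjq, add_zero, List.getD_eq_getElem?_getD, hj]
  rfl

theorem isBlock_append (hB : IsGoodMorphism l a b q B d₁ d₂) {m : ℕ} {u : List Bool}
    (hu : IsBlock (morphicImage B q) (q * (m + 1)) u) :
    IsBlock (morphicImage B q) (q * m) (B (thueMorse m) ++ u) :=
  _root_.isBlock_append.2 ⟨hB.isBlock m, by rwa [hB.length_eq, ← Nat.mul_succ]⟩

theorem isBlock_two (hB : IsGoodMorphism l a b q B d₁ d₂) (m : ℕ) :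
    IsBlock (morphicImage B q) (q * m) (B (thueMorse m) ++ B (thueMorse (m + 1))) :=
  hB.isBlock_append (hB.isBlock _)

theorem isBlock_five (hB : IsGoodMorphism l a b q B d₁ d₂) (m : ℕ) :
    IsBlock (morphicImage B q) (q * m) (B (thueMorse m) ++ (B (thueMorse (m + 1)) ++
      (B (thueMorse (m + 2)) ++ (B (thueMorse (m + 3)) ++ B (thueMorse (m + 4)))))) :=
  hB.isBlock_append <| hB.isBlock_append <| hB.isBlock_append <| hB.isBlock_append (hB.isBlock _)

/-- A match of length at least `2 * q - 1` contains a whole image of a letter. -/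
theorem agree_of_match (hB : IsGoodMorphism l a b q B d₁ d₂) {c : Bool} {i p r : ℕ}
    (hr : 2 * q - 1 ≤ r) (h : Match c (morphicImage B q) i p r) :
    ∃ m n : ℕ, agree c q (B (thueMorse m))
      ((B (thueMorse n) ++ B (thueMorse (n + 1))).drop (p % q)) = true := by
  have hq := hB.q_pos
  have h1 := Nat.div_add_mod (i + (q - 1)) q
  have h2 := Nat.mod_lt (i + (q - 1)) hq
  have h3 := Nat.div_add_mod p q
  have h4 := Nat.mod_lt p hq
  set m := (i + (q - 1)) / q
  refine ⟨m, m + p / q, _root_.agree_of_match (hB.isBlock m) ((hB.isBlock_two _).drop _)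
    (hB.length_eq _).ge ?_ fun j hj => ?_⟩
  · simp only [List.length_drop, List.length_append, hB.length_eq]
    omega
  · have h5 := h (q * m - i + j) (by omega)
    rw [show i + (q * m - i + j) = q * m + j by omega] at h5
    rw [show q * (m + p / q) + p % q + j = q * m + j + p by rw [Nat.mul_add]; omega]
    exact h5

theorem short_apply (hB : IsGoodMorphism l a b q B d₁ d₂) {i p : ℕ} (hp : 1 ≤ p)
    (hpq : p ≤ 2 * q - 2) :
    (∀ r ≤ 2 * q - 2, (a - b) * p / b + 1 ≤ r → ¬ Match false (morphicImage B q) i p r) ∧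
      (l ≤ p → ¬ Match true (morphicImage B q) i p p) := by
  have hq := hB.q_pos
  have h1 := Nat.div_add_mod i q
  have h2 := Nat.mod_lt i hq
  have hblock := (hB.isBlock_five (i / q)).drop (i % q)
  rw [h1] at hblock
  have hlen : ∀ c₀ c₁ c₂ c₃ c₄, (B c₀ ++ (B c₁ ++ (B c₂ ++ (B c₃ ++ B c₄)))).length = 5 * q := by
    intro c₀ c₁ c₂ c₃ c₄
    simp only [List.length_append, hB.length_eq]
    ring
  obtain ⟨h3, h4⟩ := noRepetitions_apply (hB.short _ _ _ _ _ (overlapFreeFive_thueMorse (i / q)))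
    h2 hp hpq
  have key : ∀ c : Bool, ∀ r ≤ 2 * q - 2, Match c (morphicImage B q) i p r →
      agree c r _ _ = true := fun c r hr h =>
    _root_.agree_of_match hblock (hblock.drop p)
      (by rw [List.length_drop, hlen]; omega)
      (by rw [List.length_drop, List.length_drop, hlen]; omega)
      (fun j hj => by
        have := h j hj
        rwa [add_right_comm] at this)
  constructor
  · intro r hr hle h
    rw [key false _ (hle.trans hr) (h.mono hle)] at h3
    exact absurd h3 (by decide)
  · intro hl h
    have h5 := h4 hl
    rw [key true p hpq h] at h5
    exact absurd h5 (by decide)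

theorem mem_AO (hB : IsGoodMorphism l a b q B d₁ d₂) : morphicImage B q ∈ AO l := by
  rw [mem_AO_iff]
  intro k hl hk i h
  rcases le_or_gt (2 * q - 1) k with hkq | hkq
  · obtain ⟨m, n, h1⟩ := hB.agree_of_match hkq h
    rw [hB.anti _ _ _ _ (Nat.mod_lt k hB.q_pos)] at h1
    exact absurd h1 (by decide)
  · exact (hB.short_apply hk (by omega)).2 hl h

/-- Each letter whose image has a place of disagreement, `d₁` or `d₂`, inside the match recurs `p`
letters later. If the match were longer, then there would be `p + 1` such letters in a row, an
overlap in the Thue–Morse word. -/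
theorem lt_of_match_mul (hB : IsGoodMorphism l a b q B d₁ d₂) {i p r : ℕ} (hp : 1 ≤ p)
    (hr : 2 * q - 1 ≤ r) (h : Match false (morphicImage B q) i (q * p) r) :
    r + d₂ < q * p + q + d₁ := by
  by_contra! hlt
  have hq := hB.q_pos
  have hd := hB.lt_q
  have h1 := Nat.div_add_mod (i + (q - 1 - d₂)) q
  have h2 := Nat.mod_lt (i + (q - 1 - d₂)) hq
  set m := (i + (q - 1 - d₂)) / q
  have letter : ∀ d < q, (B false)[d]? ≠ (B true)[d]? → ∀ k, i ≤ q * (m + k) + d →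
      q * (m + k) + d < i + r → thueMorse (m + k) = thueMorse (m + k + p) := by
    intro d hdq hne k h3 h4
    have h5 := match_false_iff.1 h (q * (m + k) + d - i) (by omega)
    rw [show i + (q * (m + k) + d - i) = q * (m + k) + d by omega,
      show q * (m + k) + d + q * p = q * (m + k + p) + d by ring] at h5
    have some : ∀ n, (B (thueMorse n))[d]? = some (morphicImage B q (q * n + d)) := by
      intro n
      have h6 : d < (B (thueMorse n)).length := by rwa [hB.length_eq]
      rw [List.getElem?_eq_getElem h6, hB.isBlock n d _ (List.getElem?_eq_getElem h6)]
    have h7 := some (m + k)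
    rw [h5, ← some (m + k + p)] at h7
    cases h8 : thueMorse (m + k) <;> cases h9 : thueMorse (m + k + p) <;> rw [h8, h9] at h7
    exacts [absurd h7 hne, absurd h7.symm hne]
  refine thueMorse_overlapFree hp m fun k hk => ?_
  rcases k with _ | k
  · exact letter d₂ hd.2 hB.ne₂ 0 (by rw [add_zero]; omega) (by rw [add_zero]; omega)
  · have h3 : q * (k + 1) ≤ q * p := Nat.mul_le_mul_left q hk
    exact letter d₁ hd.1 hB.ne₁ (k + 1) (by rw [Nat.mul_add, Nat.mul_succ]; omega)
      (by rw [Nat.mul_add]; omega)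

theorem isPlusFree (hB : IsGoodMorphism l a b q B d₁ d₂) {β : ℝ} (hβ : β = a / b) :
    IsPlusFree β (morphicImage B q) := by
  have hb : (0 : ℝ) < b := by exact_mod_cast hB.b_pos
  have hab := hB.two_mul_le
  refine isPlusFree_of_match ?_ fun i p r hp h => ?_
  · rw [hβ, le_div_iff₀ hb]
    have : (2 * b : ℝ) ≤ a := by exact_mod_cast hab
    linarith
  suffices hnat : b * (p + r) ≤ a * p by
    have : (b * (p + r) : ℝ) ≤ a * p := by exact_mod_cast hnat
    rw [hβ, div_mul_eq_mul_div, le_div_iff₀ hb]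
    linarith
  by_contra! hlt
  obtain ⟨e, rfl⟩ : ∃ e, a = 2 * b + e := ⟨a - 2 * b, by omega⟩
  rcases le_or_gt (2 * q - 1) r with hrq | hrq
  · obtain ⟨m, n, h1⟩ := hB.agree_of_match hrq h
    have h2 : p % q = 0 := by
      by_contra hne
      rw [hB.sync _ _ _ _ (Nat.mod_lt p hB.q_pos) (by omega)] at h1
      exact absurd h1 (by decide)
    obtain ⟨p', rfl⟩ := Nat.dvd_of_mod_eq_zero h2
    have hp' : 1 ≤ p' := Nat.pos_of_ne_zero (by rintro rfl; simp at hp)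
    have h3 := hB.lt_of_match_mul hp' hrq h
    have h4 := hB.extension
    have h5 : b * (r + d₂ + 1) ≤ b * (q * p' + q + d₁) := Nat.mul_le_mul_left b h3
    have h6 : e * q * 1 ≤ e * q * p' := Nat.mul_le_mul_left _ hp'
    nlinarith
  · have hpr : p < r := by
      have : b * (p + p) ≤ (2 * b + e) * p := by nlinarith
      have := lt_of_le_of_lt this hlt
      have := Nat.lt_of_mul_lt_mul_left this
      omega
    refine (hB.short_apply hp (by omega)).1 r (by omega) ?_ h
    rw [Nat.succ_le_iff, Nat.div_lt_iff_lt_mul hB.b_pos, show 2 * b + e - b = b + e by omega]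
    nlinarith

end IsGoodMorphism

/-! ### The three morphisms -/

/-- A `24`-uniform morphism under which the image of the Thue–Morse word has no antisquare of order
at least `3` and no repetition of exponent greater than `8 / 3`. Its two words come from a computer
search. -/
def threeMorphism : Bool → List Bool
  | false => [false, false, true, false, false, true, false, true, false, false, true, false, false,
      true, true, false, false, true, false, true, false, false, true, true]
  | true => [false, false, true, false, true, false, false, true, false, false, true, true, false,
      false, true, false, false, true, false, true, false, false, true, true]

theorem isGoodMorphism_threeMorphism : IsGoodMorphism 3 8 3 24 threeMorphism 4 13 where
  b_pos := by decide
  two_mul_le := by decide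
  length_eq := by decide
  sync := by decide +kernel
  anti := by decide +kernel
  lt_q := by decide
  ne₁ := by decide
  ne₂ := by decide
  extension := by decide
  short := by decide +kernel

/-- An `11`-uniform morphism for order `5` and exponent `5 / 2`, also from a search. -/
def fiveMorphism : Bool → List Bool
  | false => [false, false, true, false, true, false, false, true, false, true, true]
  | true => [false, true, false, false, true, false, true, false, false, true, true]

theorem isGoodMorphism_fiveMorphism : IsGoodMorphism 5 5 2 11 fiveMorphism 1 7 where
  b_pos := by decide
  two_mul_le := by decide
  length_eq := by decide
  sync := by decide +kernel
  anti := by decide +kernel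
  lt_q := by decide
  ne₁ := by decide
  ne₂ := by decide
  extension := by decide
  short := by decide +kernel

/-- A `37`-uniform morphism for order `6` and exponent `7 / 3`, also from a search. -/
def sixMorphism : Bool → List Bool
  | false => [false, false, true, false, false, true, true, false, false, true, false, true, true,
      false, false, true, false, false, true, true, false, true, false, false, true, false,
      true, true, false, true, false, false, true, true, false, true, true]
  | true => [false, false, true, false, false, true, true, false, true, true, false, false, true,
      false, true, true, false, false, true, true, false, true, true, false, false, true,
      false, true, true, false, true, false, false, true, false, true, true]

theorem isGoodMorphism_sixMorphism : IsGoodMorphism 6 7 3 37 sixMorphism 8 32 where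
  b_pos := by decide
  two_mul_le := by decide
  length_eq := by decide
  sync := by decide +kernel
  anti := by decide +kernel
  lt_q := by decide
  ne₁ := by decide
  ne₂ := by decide
  extension := by decide
  short := by decide +kernel

/-! ### Finite backtracking for the optimality claims -/

/-- A finite check: every word of `30` letters contains one of the listed patterns, which are
antisquares of order at least `3` or repetitions of exponent at least `8 / 3`. The refutations below
are of the same kind, and each list holds only the patterns that its search needs. -/
theorem not_isFree_eight_thirds {w : ℕ → Bool} (hl : w ∈ AO 3) :
    ¬ IsFree (8 / 3) w := fun hw =>
  not_avoids_of_search (n := 30) (T := [(false, 1, 2), (true, 4, 4), (false, 3, 5), (true, 5, 5),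
      (false, 2, 4), (true, 7, 7), (false, 4, 7), (true, 11, 11), (false, 9, 15)])
    (by decide +kernel)
    (hw.avoids (a := 8) (b := 3) hl (by norm_num) (by norm_num) (by decide))

theorem not_isFree_five_halves {w : ℕ → Bool} (hl : w ∈ AO 5) :
    ¬ IsFree (5 / 2) w := fun hw =>
  not_avoids_of_search (n := 33) (T := [(false, 1, 2), (false, 2, 3), (false, 3, 5), (true, 5, 5),
      (false, 4, 6), (true, 8, 8), (true, 10, 10), (false, 6, 9), (false, 8, 12)])
    (by decide +kernel)
    (hw.avoids (a := 5) (b := 2) hl (by norm_num) (by norm_num) (by decide))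

theorem not_isFree_seven_thirds {w : ℕ → Bool} (hl : w ∈ AO 6) :
    ¬ IsFree (7 / 3) w := fun hw =>
  not_avoids_of_search (n := 31) (T := [(false, 1, 2), (false, 3, 4), (false, 2, 3), (false, 4, 6),
      (false, 6, 8), (true, 8, 8), (false, 8, 11)])
    (by decide +kernel)
    (hw.avoids (a := 7) (b := 3) hl (by norm_num) (by norm_num) (by decide))

theorem not_isPlusFree_two_add_goldenRatio {w : ℕ → Bool} (hl : w ∈ AO 1) :
    ¬ IsPlusFree (2 + Real.goldenRatio) w := fun hw =>
  not_avoids_of_search (n := 5) (T := [(true, 1, 1), (false, 1, 4)]) (by decide +kernel)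
    (hw.avoids (a := 4) (b := 1) hl (by norm_num)
      (by linarith [Real.goldenRatio_lt_two]) (by decide))

theorem not_isPlusFree_eight_thirds {w : ℕ → Bool} (hl : w ∈ AO 2) :
    ¬ IsPlusFree (8 / 3) w := fun hw =>
  not_avoids_of_search (n := 8) (T := [(false, 1, 2), (true, 2, 2), (false, 2, 4)])
    (by decide +kernel)
    (hw.avoids (a := 8) (b := 3) hl (by norm_num) (by norm_num) (by decide))

theorem not_isPlusFree_five_halves {w : ℕ → Bool} (hl : w ∈ AO 4) :
    ¬ IsPlusFree (5 / 2) w := fun hw =>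
  not_avoids_of_search (n := 30) (T := [(false, 1, 2), (true, 4, 4), (false, 3, 5), (true, 5, 5),
      (false, 2, 4), (true, 7, 7), (false, 4, 7), (true, 11, 11), (false, 9, 14)])
    (by decide +kernel)
    (hw.avoids (a := 5) (b := 2) hl (by norm_num) (by norm_num) (by decide))

theorem not_isPlusFree_seven_thirds {w : ℕ → Bool} (hl : w ∈ AO 5) :
    ¬ IsPlusFree (7 / 3) w := fun hw =>
  not_avoids_of_search (n := 33) (T := [(false, 1, 2), (false, 2, 3), (false, 3, 5), (true, 5, 5),
      (false, 4, 6), (true, 8, 8), (true, 10, 10), (false, 6, 9), (false, 8, 11)])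
    (by decide +kernel)
    (hw.avoids (a := 7) (b := 3) hl (by norm_num) (by norm_num) (by decide))

/-! ### The Fibonacci word as a rotation word -/

/-- The reciprocal `1 / φ = φ - 1` of the golden ratio. -/
noncomputable def invPhi : ℝ := Real.goldenRatio - 1

theorem invPhi_eq : invPhi = -Real.goldenConj := by
  rw [invPhi, ← Real.goldenRatio_add_goldenConj]
  ring

theorem goldenConj_eq : Real.goldenConj = -invPhi := by
  rw [invPhi_eq, neg_neg]

theorem invPhi_sq : invPhi ^ 2 = 1 - invPhi := by
  rw [invPhi_eq, neg_sq, Real.goldenConj_sq]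
  ring

theorem invPhi_pos : 0 < invPhi := by
  rw [invPhi_eq]
  linarith [Real.goldenConj_neg]

theorem invPhi_bounds : 1 / 2 < invPhi ∧ invPhi < 2 / 3 := by
  have := invPhi_sq
  have := invPhi_pos
  constructor <;> nlinarith

theorem invPhi_pow_succ_add (n : ℕ) : invPhi ^ (n + 1) + invPhi ^ (n + 2) = invPhi ^ n := by
  rw [pow_succ, pow_add, invPhi_sq]
  ring

theorem fib_mul_invPhi (n : ℕ) :
    (Nat.fib (n + 1) : ℝ) * invPhi = Nat.fib n - Real.goldenConj ^ (n + 1) := by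
  have h := Real.fib_succ_sub_goldenRatio_mul_fib (n + 1)
  have h2 : (Nat.fib (n + 2) : ℝ) = Nat.fib n + Nat.fib (n + 1) := by
    exact_mod_cast Nat.fib_add_two
  rw [← h, show n + 1 + 1 = n + 2 from rfl, h2, invPhi]
  ring

theorem exists_fib_combination (n : ℕ) (p D : ℤ) :
    ∃ a b : ℤ, p = a * Nat.fib (n + 1) + b * Nat.fib (n + 2) ∧
      D = a * Nat.fib n + b * Nat.fib (n + 1) := by
  induction n with
  | zero => exact ⟨p - D, D, by simp, by simp⟩
  | succ n ih =>
    obtain ⟨a, b, h1, h2⟩ := ih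
    have e1 : (Nat.fib (n + 2) : ℤ) = Nat.fib n + Nat.fib (n + 1) := by
      exact_mod_cast Nat.fib_add_two
    have e2 : (Nat.fib (n + 3) : ℤ) = Nat.fib (n + 1) + Nat.fib (n + 2) := by
      exact_mod_cast Nat.fib_add_two
    refine ⟨b - a, a, ?_, ?_⟩
    · rw [h1, show n + 1 + 1 = n + 2 from rfl, show n + 1 + 2 = n + 3 from rfl, e2]
      ring
    · rw [h2, show n + 1 + 1 = n + 2 from rfl, e1]
      ring

/-- The convergents of `1 / φ` are its best approximations: in the basis of two consecutive pairs of
Fibonacci numbers, an integer pair `(p, D)` with `0 < p < fib (n + 2)` has coordinates of opposite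
signs, whose contributions to `p / φ - D` add up. -/
theorem le_abs_mul_invPhi_sub {n : ℕ} {p : ℤ} (hp : 0 < p) (hpn : p < Nat.fib (n + 2)) (D : ℤ) :
    invPhi ^ (n + 1) ≤ |p * invPhi - D| := by
  obtain ⟨a, b, h1, h2⟩ := exists_fib_combination n p D
  have e : (p : ℝ) * invPhi - D = Real.goldenConj ^ (n + 1) * (b * invPhi - a) := by
    have e1 := fib_mul_invPhi n
    have e2 := fib_mul_invPhi (n + 1)
    have h1' : (p : ℝ) = a * Nat.fib (n + 1) + b * Nat.fib (n + 2) := by exact_mod_cast h1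
    have h2' : (D : ℝ) = a * Nat.fib n + b * Nat.fib (n + 1) := by exact_mod_cast h2
    rw [h1', h2', add_mul, mul_assoc, mul_assoc, e1, e2, pow_succ _ (n + 1),
      goldenConj_eq]
    ring
  have hpow : |Real.goldenConj ^ (n + 1)| = invPhi ^ (n + 1) := by
    rw [abs_pow, goldenConj_eq, abs_neg, abs_of_pos invPhi_pos]
  rw [e, abs_mul, hpow]
  refine le_mul_of_one_le_right (pow_pos invPhi_pos _).le ?_
  have f1 : (0 : ℤ) < Nat.fib (n + 1) := by exact_mod_cast Nat.fib_pos.2 (by omega)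
  have f2 : (0 : ℤ) < Nat.fib (n + 2) := by exact_mod_cast Nat.fib_pos.2 (by omega)
  have hφ := invPhi_pos
  rcases lt_trichotomy b 0 with hb | rfl | hb
  · have ha : 0 < a := by
      by_contra! ha
      nlinarith
    have ha' : (1 : ℝ) ≤ a := by exact_mod_cast ha
    have hb' : (b : ℝ) < 0 := by exact_mod_cast hb
    rw [abs_of_neg] <;> nlinarith
  · have ha : a ≠ 0 := by
      rintro rfl
      omega
    have : (1 : ℝ) ≤ |(a : ℝ)| := by exact_mod_cast Int.one_le_abs ha
    simpa using this
  · have ha : a < 0 := by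
      by_contra! ha
      nlinarith
    have ha' : (a : ℝ) ≤ -1 := by exact_mod_cast Int.le_sub_one_of_lt ha
    have hb' : (0 : ℝ) < b := by exact_mod_cast hb
    rw [abs_of_pos] <;> nlinarith

/-- The integer `x` visits the interval `[c, c + δ)` modulo `1` under rotation by `1 / φ`. -/
def Visits (c δ : ℝ) (x : ℤ) : Prop :=
  ∃ D : ℤ, c ≤ x * invPhi - D ∧ x * invPhi - D < c + δ

/-- The first return to an interval of length `φ ^ (-n)` takes `fib (n + 1)` or `fib (n + 2)` steps,
here backwards: these rotate in opposite directions, by distances that add up to the length of the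
interval. -/
theorem Visits.exists_sub {n : ℕ} {c : ℝ} {x : ℤ} (h : Visits c (invPhi ^ n) x) :
    Visits c (invPhi ^ n) (x - Nat.fib (n + 1)) ∨ Visits c (invPhi ^ n) (x - Nat.fib (n + 2)) := by
  obtain ⟨D, h1, h2⟩ := h
  have hadd := invPhi_pow_succ_add n
  have e1 := fib_mul_invPhi n
  have e2 := fib_mul_invPhi (n + 1)
  have p1 := pow_pos invPhi_pos (n + 1)
  have p2 := pow_pos invPhi_pos (n + 2)
  rw [show n + 1 + 1 = n + 2 from rfl] at e2
  rcases Nat.even_or_odd n with hn | hn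
  · rw [goldenConj_eq, hn.add_one.neg_pow] at e1
    rw [goldenConj_eq, (hn.add (by decide : Even 2)).neg_pow] at e2
    by_cases hc : c + invPhi ^ (n + 1) ≤ x * invPhi - D
    · refine .inl ⟨D - Nat.fib n, ?_⟩
      push_cast
      constructor <;> linarith
    · refine .inr ⟨D - Nat.fib (n + 1), ?_⟩
      push_cast
      constructor <;> linarith
  · rw [goldenConj_eq, hn.add_one.neg_pow] at e1
    rw [goldenConj_eq, (hn.add_even (by decide : Even 2)).neg_pow] at e2
    by_cases hc : c + invPhi ^ (n + 2) ≤ x * invPhi - D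
    · refine .inr ⟨D - Nat.fib (n + 1), ?_⟩
      push_cast
      constructor <;> linarith
    · refine .inl ⟨D - Nat.fib n, ?_⟩
      push_cast
      constructor <;> linarith

theorem Visits.exists_lt {n : ℕ} {c : ℝ} (a : ℤ) (k : ℕ)
    (h : Visits c (invPhi ^ n) (a + k)) :
    ∃ x : ℤ, a ≤ x ∧ x < a + Nat.fib (n + 2) ∧ Visits c (invPhi ^ n) x := by
  induction k using Nat.strong_induction_on with
  | _ k ih =>
    by_cases hk : k < Nat.fib (n + 2)
    · exact ⟨a + k, by omega, by omega, h⟩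
    · have f1 : 0 < Nat.fib (n + 1) := Nat.fib_pos.2 (by omega)
      have f2 : 0 < Nat.fib (n + 2) := Nat.fib_pos.2 (by omega)
      have f3 : Nat.fib (n + 1) ≤ Nat.fib (n + 2) := Nat.fib_mono (by omega)
      rcases h.exists_sub with h | h
      · refine ih (k - Nat.fib (n + 1)) (by omega) ?_
        rwa [Nat.cast_sub (by omega), ← add_sub_assoc]
      · refine ih (k - Nat.fib (n + 2)) (by omega) ?_
        rwa [Nat.cast_sub (by omega), ← add_sub_assoc]

theorem exists_le_fib (a k : ℕ) : ∃ m, k ≤ m ∧ a ≤ Nat.fib m :=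
  ⟨max k (a + 5), le_max_left _ _,
    (Nat.le_fib_self (n := max k (a + 5)) (by omega)).trans' (by omega)⟩

/-- Among `fib (n + 2)` consecutive integers, one visits `[-φ ^ (-n), 0)`, and one visits
`[0, φ ^ (-n))`. The large Fibonacci numbers visit these intervals, depending on the parity of their
index; the statement follows by descending from there. -/
theorem exists_visits (n a : ℕ) (s : Bool) : ∃ x : ℕ, a ≤ x ∧ x < a + Nat.fib (n + 2) ∧
    Visits (cond s (-invPhi ^ n) 0) (invPhi ^ n) x := by
  have hb := invPhi_bounds
  obtain ⟨m, hm, ham⟩ := exists_le_fib a (n + 1)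
  have hpar : ∃ m', n ≤ m' ∧ a ≤ Nat.fib (m' + 1) ∧ (if s then Odd m' else Even m') := by
    cases s <;> rcases Nat.even_or_odd m with he | ho
    · exact ⟨m, by omega, ham.trans (Nat.fib_mono (by omega)), by simpa⟩
    · exact ⟨m + 1, by omega, ham.trans (Nat.fib_mono (by omega)), by simpa using ho.add_one⟩
    · exact ⟨m + 1, by omega, ham.trans (Nat.fib_mono (by omega)), by simpa using he.add_one⟩
    · exact ⟨m, by omega, ham.trans (Nat.fib_mono (by omega)), by simpa⟩
  obtain ⟨m', hm', ham', hs⟩ := hpar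
  have e := fib_mul_invPhi m'
  have hle : invPhi ^ (m' + 1) < invPhi ^ n :=
    pow_lt_pow_right_of_lt_one₀ (by linarith) (by linarith) (by omega)
  have hpos := pow_pos invPhi_pos (m' + 1)
  have hv : Visits (cond s (-invPhi ^ n) 0) (invPhi ^ n)
      ((a : ℤ) + (Nat.fib (m' + 1) - a : ℕ)) := by
    rw [Nat.cast_sub ham', add_sub_cancel]
    refine ⟨Nat.fib m', ?_⟩
    cases s
    · have hs' : Even m' := by simpa using hs
      rw [goldenConj_eq, hs'.add_one.neg_pow] at e
      simp only [cond_false]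
      push_cast
      constructor <;> linarith
    · have hs' : Odd m' := by simpa using hs
      rw [goldenConj_eq, hs'.add_one.neg_pow] at e
      simp only [cond_true]
      push_cast
      constructor <;> linarith
  obtain ⟨x, h1, h2, h3⟩ := hv.exists_lt
  lift x to ℕ using by omega
  exact ⟨x, by omega, by omega, h3⟩

/-- The integer part of `i / φ`. -/
noncomputable def rot (i : ℕ) : ℤ := ⌊(i : ℝ) * invPhi⌋

/-- The Fibonacci word, with `true` as its more frequent letter, as the word of the increments
of `⌊i / φ⌋`. -/
noncomputable def fibWord (i : ℕ) : Bool := decide (rot (i + 1) = rot i + 1)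

theorem rot_succ (i : ℕ) : rot (i + 1) = rot i + cond (fibWord i) 1 0 := by
  by_cases h : rot (i + 1) = rot i + 1
  · simp [fibWord, h]
  · simp only [fibWord, h, decide_false, cond_false, add_zero]
    have hb := invPhi_bounds
    have h1 : rot i ≤ rot (i + 1) := by
      refine Int.floor_mono ?_
      push_cast
      linarith
    have h2 : rot (i + 1) < rot i + 2 := by
      rw [rot, Int.floor_lt]
      have := Int.lt_floor_add_one ((i : ℝ) * invPhi)
      push_cast
      rw [rot]
      linarith
    omega

theorem fibWord_no_two_false (i : ℕ) : fibWord i = true ∨ fibWord (i + 1) = true := by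
  by_contra! h
  have h1 := rot_succ i
  have h2 := rot_succ (i + 1)
  simp only [Bool.not_eq_true] at h
  rw [h.1] at h1
  rw [h.2] at h2
  have hb := invPhi_bounds
  have h3 : rot i + 1 ≤ rot (i + 2) := by
    rw [rot, rot, Int.le_floor]
    have := Int.floor_le ((i : ℝ) * invPhi)
    push_cast
    linarith
  rw [show i + 1 + 1 = i + 2 from rfl] at h2
  simp at h1 h2
  omega

theorem fibWord_no_three_true (i : ℕ) :
    ¬ (fibWord i = true ∧ fibWord (i + 1) = true ∧ fibWord (i + 2) = true) := by
  rintro ⟨h1, h2, h3⟩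
  have e1 := rot_succ i
  have e2 := rot_succ (i + 1)
  have e3 := rot_succ (i + 2)
  rw [h1] at e1
  rw [h2] at e2
  rw [h3] at e3
  have hb := invPhi_bounds
  have h4 : rot (i + 3) < rot i + 3 := by
    rw [rot, rot, Int.floor_lt]
    have := Int.lt_floor_add_one ((i : ℝ) * invPhi)
    push_cast
    linarith
  rw [show i + 1 + 1 = i + 2 from rfl] at e2
  rw [show i + 2 + 1 = i + 3 from rfl] at e3
  simp at e1 e2 e3
  omega

/-- A repetition of period `p < fib (n + 2)` in the Fibonacci word has length at most
`p + fib (n + 3) - 2`. -/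
theorem fibWord_match_lt {n i p r : ℕ} (hp : 1 ≤ p) (hpn : p < Nat.fib (n + 2))
    (h : Match false fibWord i p r) : r + 1 < Nat.fib (n + 3) := by
  by_contra! hr
  rw [match_false_iff] at h
  have hD : ∀ j ≤ r, rot (i + j + p) - rot (i + j) = rot (i + p) - rot i := by
    intro j hj
    induction j with
    | zero => rfl
    | succ j ih =>
      rw [← ih (by omega), show i + (j + 1) + p = (i + j + p) + 1 by omega, ← add_assoc,
        rot_succ, rot_succ, h j (by omega)]
      ring
  set D := rot (i + p) - rot i
  have hbest := le_abs_mul_invPhi_sub (n := n) (p := p) (by exact_mod_cast hp)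
    (by exact_mod_cast hpn) D
  have hpos := pow_pos invPhi_pos (n + 1)
  have hb := invPhi_bounds
  have hle1 : invPhi ^ (n + 1) ≤ 1 := pow_le_one₀ (by linarith) (by linarith)
  -- A visit to the interval of length `|p / φ - D|` on the correct side of `0` contradicts `hD`.
  rcases lt_or_ge 0 ((p : ℝ) * invPhi - D) with hε | hε
  · obtain ⟨x, hx1, hx2, E, hE1, hE2⟩ := exists_visits (n + 1) i true
    rw [show n + 1 + 2 = n + 3 from rfl] at hx2
    obtain ⟨j, rfl⟩ := Nat.exists_eq_add_of_le hx1
    have h1 := hD j (by omega)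
    rw [Int.cast_natCast, abs_of_pos hε] at hbest
    simp only [cond_true] at hE1 hE2
    push_cast at hE1 hE2
    have h2 : rot (i + j) < E := by
      rw [rot, Int.floor_lt]
      push_cast
      linarith
    have h3 : E + D ≤ rot (i + j + p) := by
      rw [rot, Int.le_floor]
      push_cast
      linarith
    omega
  · obtain ⟨x, hx1, hx2, E, hE1, hE2⟩ := exists_visits (n + 1) i false
    rw [show n + 1 + 2 = n + 3 from rfl] at hx2
    obtain ⟨j, rfl⟩ := Nat.exists_eq_add_of_le hx1
    have h1 := hD j (by omega)
    rw [Int.cast_natCast, abs_of_nonpos hε] at hbest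
    simp only [cond_false] at hE1 hE2
    push_cast at hE1 hE2
    have h2 : E ≤ rot (i + j) := by
      rw [rot, Int.le_floor]
      push_cast
      linarith
    have h3 : rot (i + j + p) < E + D := by
      rw [rot, Int.floor_lt]
      push_cast
      linarith
    omega

/-! ### Interleaving the Fibonacci word with zeros -/

/-- The word `0 v₀ 0 v₁ 0 v₂ ⋯`, where `v` is the Fibonacci word. -/
noncomputable def paddedFibWord (n : ℕ) : Bool := decide (n % 2 = 1) && fibWord (n / 2)

theorem paddedFibWord_even {n : ℕ} (h : n % 2 = 0) : paddedFibWord n = false := by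
  simp [paddedFibWord, h]

theorem paddedFibWord_odd (k : ℕ) : paddedFibWord (2 * k + 1) = fibWord k := by
  simp [paddedFibWord, show (2 * k + 1) / 2 = k by omega]

theorem paddedFibWord_mem_AO : paddedFibWord ∈ AO 2 := by
  rw [mem_AO_iff]
  intro k hk _ i h
  rw [match_true_iff] at h
  rcases Nat.mod_two_eq_zero_or_one k with hk2 | hk2
  · -- An even position among the first two recurs, `k` places later, at an even position.
    have h1 := h (i % 2) (by omega)
    rw [paddedFibWord_even (by omega), paddedFibWord_even (by omega)] at h1
    exact absurd h1 (by decide)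
  · -- All letters at odd positions are `1`, and there are at least three of them.
    have h1 : ∀ m, i ≤ 2 * m + 1 → 2 * m + 1 < i + 2 * k → fibWord m = true := by
      intro m h1 h2
      rcases lt_or_ge (2 * m + 1) (i + k) with h3 | h3
      · have h4 := h (2 * m + 1 - i) (by omega)
        rw [paddedFibWord_even (by omega), show i + (2 * m + 1 - i) = 2 * m + 1 by omega,
          paddedFibWord_odd] at h4
        simpa using h4.symm
      · have h4 := h (2 * m + 1 - i - k) (by omega)
        rw [paddedFibWord_even (n := i + (2 * m + 1 - i - k)) (by omega),
          show i + (2 * m + 1 - i - k) + k = 2 * m + 1 by omega, paddedFibWord_odd] at h4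
        simpa using h4
    exact fibWord_no_three_true (i / 2) ⟨h1 _ (by omega) (by omega), h1 _ (by omega) (by omega),
      h1 _ (by omega) (by omega)⟩

theorem paddedFibWord_isPlusFree : IsPlusFree (2 + Real.goldenRatio) paddedFibWord := by
  have hφ : Real.goldenRatio = 1 + invPhi := by
    rw [invPhi]
    ring
  have hb := invPhi_bounds
  refine isPlusFree_of_match (by linarith) fun i p r hp h => ?_
  obtain ⟨k, rfl | rfl⟩ : ∃ k, p = 2 * k ∨ p = 2 * k + 1 := ⟨p / 2, by omega⟩
  · -- Even period: the odd positions carry a repetition of the Fibonacci word.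
    have hk : k < Nat.fib (k.greatestFib + 1) := Nat.lt_fib_greatestFib_add_one k
    obtain ⟨n, hn⟩ : ∃ n, k.greatestFib = n + 1 := by
      refine ⟨k.greatestFib - 1, ?_⟩
      have := Nat.greatestFib_pos.2 (show 0 < k by omega)
      omega
    have hle := Nat.fib_greatestFib_le k
    rw [hn] at hk hle
    have hv : Match false fibWord (i / 2) k ((i + r) / 2 - i / 2) := by
      rw [match_false_iff] at h ⊢
      intro j hj
      have h1 := h (2 * (i / 2 + j) + 1 - i) (by omega)
      rw [show i + (2 * (i / 2 + j) + 1 - i) = 2 * (i / 2 + j) + 1 by omega,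
        show 2 * (i / 2 + j) + 1 + 2 * k = 2 * (i / 2 + j + k) + 1 by omega,
        paddedFibWord_odd, paddedFibWord_odd] at h1
      exact h1
    have h1 := fibWord_match_lt (by omega) hk hv
    have h2 : r + 3 ≤ 2 * Nat.fib (n + 3) := by omega
    have h3 : (r + 3 : ℝ) ≤ 2 * Nat.fib (n + 3) := by exact_mod_cast h2
    have h4 := Real.fib_succ_sub_goldenRatio_mul_fib (n + 1)
    have h5 : (Nat.fib (n + 3) : ℝ) = Nat.fib (n + 1) + Nat.fib (n + 2) := by
      exact_mod_cast Nat.fib_add_two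
    have h6 : Real.goldenConj ^ (n + 1) ≤ 1 := by
      refine (le_abs_self _).trans ?_
      rw [abs_pow, goldenConj_eq, abs_neg, abs_of_pos invPhi_pos]
      exact pow_le_one₀ (by linarith) (by linarith)
    have h7 : (Nat.fib (n + 1) : ℝ) ≤ k := by exact_mod_cast hle
    rw [show n + 1 + 1 = n + 2 from rfl] at h4
    push_cast
    nlinarith
  · -- Odd period: the matching letters are all `0`, so that there are few of them.
    rw [match_false_iff] at h
    have h1 : ∀ m, i ≤ 2 * m + 1 → 2 * m + 1 < i + r → fibWord m = false := by
      intro m h1 h2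
      have h3 := h (2 * m + 1 - i) (by omega)
      rw [show i + (2 * m + 1 - i) = 2 * m + 1 by omega, paddedFibWord_odd,
        paddedFibWord_even (by omega)] at h3
      exact h3
    have hr : r ≤ 3 := by
      by_contra! hr
      rcases fibWord_no_two_false (i / 2) with h2 | h2
      · rw [h1 _ (by omega) (by omega)] at h2
        exact absurd h2 (by decide)
      · rw [h1 _ (by omega) (by omega)] at h2
        exact absurd h2 (by decide)
    rcases Nat.eq_zero_or_pos k with rfl | hk
    · have hr2 : r ≤ 2 := by
        by_contra! hr
        rcases fibWord_no_two_false (i / 2) with h2 | h2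
        · rw [h1 _ (by omega) (by omega)] at h2
          exact absurd h2 (by decide)
        · have h3 := h (2 * (i / 2) + 2 - i) (by omega)
          rw [paddedFibWord_even (by omega),
            show i + (2 * (i / 2) + 2 - i) + (2 * 0 + 1) = 2 * (i / 2 + 1) + 1 by omega,
            paddedFibWord_odd, h2] at h3
          exact absurd h3 (by decide)
      have : (r : ℝ) ≤ 2 := by exact_mod_cast hr2
      push_cast
      linarith
    · have : (r : ℝ) ≤ 3 := by exact_mod_cast hr
      have : (1 : ℝ) ≤ k := by exact_mod_cast hk
      push_cast
      nlinarith

/-! ### Words with antisquares of order one only -/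

/-- In a sufficiently long word with few repetitions and no antisquare of order at least `2`, read
off at its places `1, …, 7`: three equal letters at distance `2` are followed by a fourth, and
either the odd or the even places start with three equal letters. -/
def alternatesConstant : List Bool → Bool
  | _ :: a₁ :: b₁ :: a₂ :: b₂ :: a₃ :: b₃ :: a₄ :: _ =>
    cond (a₁ == a₂ && a₂ == a₃) (a₄ == a₁) (b₁ == b₂ && b₂ == b₃)
  | _ => false

theorem exists_alternate_constant {γ : ℝ} {w : ℕ → Bool} (hw : IsFree γ w) (hl : w ∈ AO 2)
    (hγ : γ ≤ 11 / 3) : ∃ s c, ∀ j, w (s + 2 * j) = c := by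
  have hav : Avoids w [(true, 2, 2), (true, 3, 3), (true, 5, 5), (false, 1, 3), (false, 2, 6)] :=
    hw.avoids (a := 11) (b := 3) hl (by norm_num) (by exact_mod_cast hγ) (by decide)
  have key : ∀ i, (w (i + 1) = w (i + 3) ∧ w (i + 3) = w (i + 5) ∧ w (i + 7) = w (i + 1)) ∨
      ((w (i + 1) ≠ w (i + 3) ∨ w (i + 3) ≠ w (i + 5)) ∧
        w (i + 2) = w (i + 4) ∧ w (i + 4) = w (i + 6)) := by
    intro i
    obtain ⟨v, hv, hb, hs⟩ := hav.of_search (leaf := alternatesConstant) (n := 10) (i := i)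
      (u := []) (by decide +kernel) (isBlock_nil _ _)
    match v, hv, hb, hs with
    | [a₀, a₁, b₁, a₂, b₂, a₃, b₃, a₄, b₄, a₅], hv, hb, hs =>
      rw [hb 1 a₁ rfl, hb 2 b₁ rfl, hb 3 a₂ rfl, hb 4 b₂ rfl, hb 5 a₃ rfl, hb 6 b₃ rfl,
        hb 7 a₄ rfl]
      clear hb hv
      revert hs
      revert a₁ b₁ a₂ b₂ a₃ b₃ a₄
      simp only [alternatesConstant]
      decide
  -- Three equal letters at distance `2` propagate to the right for ever.
  have main : ∀ s, w (s + 1) = w (s + 3) → w (s + 3) = w (s + 5) →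
      ∃ s c, ∀ j, w (s + 2 * j) = c := by
    intro s h1 h2
    refine ⟨s + 1, w (s + 1), fun j => ?_⟩
    have : w (s + 1 + 2 * j) = w (s + 1) ∧ w (s + 3 + 2 * j) = w (s + 1) ∧
        w (s + 5 + 2 * j) = w (s + 1) := by
      induction j with
      | zero => exact ⟨rfl, h1.symm, (h1.trans h2).symm⟩
      | succ j ih =>
        obtain ⟨e1, e2, e3⟩ := ih
        rw [show s + 1 + 2 * (j + 1) = s + 3 + 2 * j by ring,
          show s + 3 + 2 * (j + 1) = s + 5 + 2 * j by ring]
        refine ⟨e2, e3, ?_⟩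
        have k := key (s + 2 * j)
        rw [show s + 2 * j + 1 = s + 1 + 2 * j by ring, show s + 2 * j + 3 = s + 3 + 2 * j by ring,
          show s + 2 * j + 5 = s + 5 + 2 * j by ring,
          show s + 2 * j + 7 = s + 5 + 2 * (j + 1) by ring, e1, e2, e3] at k
        simpa using k
    exact this.1
  rcases key 0 with ⟨h1, h2, -⟩ | ⟨-, h1, h2⟩
  · exact main 0 h1 h2
  · exact main 1 h1 h2

/-! ### Finite Fibonacci words -/

/-- The finite Fibonacci words `1, 10, 101, 10110, …`. -/
def fibBlock : ℕ → List Bool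
  | 0 => [true]
  | 1 => [true, false]
  | n + 2 => fibBlock (n + 1) ++ fibBlock n

/-- The words `fibBlock (n - 1) ++ ⋯ ++ fibBlock 0`. For `n ≥ 1` this is the longest common prefix
of `fibBlock n ++ fibBlock (n - 1)` and `fibBlock (n - 1) ++ fibBlock n`. -/
def fibPrefix : ℕ → List Bool
  | 0 => []
  | n + 1 => fibBlock n ++ fibPrefix n

theorem length_fibBlock (n : ℕ) : (fibBlock n).length = Nat.fib (n + 2) := by
  induction n using Nat.twoStepInduction with
  | zero => rfl
  | one => rfl
  | more n h1 h2 =>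
    rw [fibBlock, List.length_append, h1, h2, add_comm]
    exact Nat.fib_add_two.symm

theorem length_fibPrefix (n : ℕ) : (fibPrefix n).length + 2 = Nat.fib (n + 3) := by
  induction n with
  | zero => rfl
  | succ n ih =>
    rw [fibPrefix, List.length_append, add_assoc, ih, length_fibBlock]
    exact Nat.fib_add_two.symm

theorem fibPrefix_prefix (n : ℕ) : fibPrefix (n + 1) <+: fibBlock (n + 1) ++ fibBlock n ∧
    fibPrefix (n + 1) <+: fibBlock n ++ fibBlock (n + 1) := by
  induction n with
  | zero => decide
  | succ n ih =>
    rw [fibPrefix]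
    constructor
    · rw [fibBlock, List.append_assoc, List.prefix_append_right_inj]
      exact ih.2
    · rw [fibBlock, List.prefix_append_right_inj]
      exact ih.1

theorem fibBlock_prefix_succ (n : ℕ) : fibBlock n <+: fibBlock (n + 1) := by
  cases n with
  | zero => decide
  | succ n => exact List.prefix_append _ _

theorem fibPrefix_prefix_append (n : ℕ) :
    fibPrefix (n + 1) <+: fibBlock (n + 1) ++ fibPrefix (n + 1) := by
  refine (fibPrefix_prefix n).1.trans ?_
  rw [List.prefix_append_right_inj, fibPrefix]
  exact List.prefix_append _ _

theorem IsBlock.of_prefix {w : ℕ → Bool} {i : ℕ} {u v : List Bool} (h : IsBlock w i u)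
    (hv : v <+: u) : IsBlock w i v := by
  obtain ⟨t, rfl⟩ := hv
  exact (isBlock_append.1 h).1

theorem match_of_isBlock {w : ℕ → Bool} {i p : ℕ} {u v : List Bool} (hu : IsBlock w i u)
    (hv : IsBlock w (i + p) v) (h : v <+: u) : Match false w i p v.length := by
  rw [match_false_iff]
  intro j hj
  have h1 := List.getElem?_eq_getElem hj
  rw [add_right_comm, hv j _ h1, (hu.of_prefix h) j _ h1]

/-! ### Desubstitution -/

/-- From each position in the set `Q`, the word `v` continues with `fibBlock n` or
`fibBlock (n + 1)`, up to a position which is again in `Q`. -/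
def Parses (v : ℕ → Bool) (n : ℕ) (Q : Set ℕ) : Prop :=
  ∀ i ∈ Q, (IsBlock v i (fibBlock n) ∧ i + (fibBlock n).length ∈ Q) ∨
    (IsBlock v i (fibBlock (n + 1)) ∧ i + (fibBlock (n + 1)).length ∈ Q)

theorem Parses.isBlock {v : ℕ → Bool} {n : ℕ} {Q : Set ℕ} (h : Parses v n Q) {i : ℕ}
    (hi : i ∈ Q) : IsBlock v i (fibBlock n) := by
  rcases h i hi with ⟨h1, -⟩ | ⟨h1, -⟩
  · exact h1
  · exact h1.of_prefix (fibBlock_prefix_succ n)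

theorem Parses.isBlock_fibPrefix {v : ℕ → Bool} {n : ℕ} {Q : Set ℕ} (h : Parses v n Q) {i : ℕ}
    (hi : i ∈ Q) : IsBlock v i (fibPrefix (n + 1)) := by
  cases n with
  | zero => exact h.isBlock hi
  | succ n =>
    have start : ∀ k ∈ Q, IsBlock v k (fibBlock (n + 1) ++ fibBlock n) := by
      intro k hk
      rcases h k hk with ⟨h1, h2⟩ | ⟨h1, -⟩
      · exact isBlock_append.2 ⟨h1, (h.isBlock h2).of_prefix (fibBlock_prefix_succ n)⟩
      · exact h1
    rw [fibPrefix]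
    rcases h i hi with ⟨h1, h2⟩ | ⟨h1, h2⟩
    · exact isBlock_append.2 ⟨h1, (start _ h2).of_prefix (fibPrefix_prefix n).1⟩
    · have h3 := isBlock_append.2 ⟨h1, h.isBlock h2⟩
      rw [fibBlock, List.append_assoc] at h3
      refine h3.of_prefix ?_
      rw [List.prefix_append_right_inj]
      exact (fibPrefix_prefix n).2

/-- If the shorter block never occurs twice in a row, then the parsing can be lifted to the next
level: cut before the longer blocks only. -/
theorem Parses.succ {v : ℕ → Bool} {n : ℕ} {Q : Set ℕ} (h : Parses v n Q) (hQ : Q.Nonempty)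
    (hsq : ∀ i ∈ Q, IsBlock v i (fibBlock n) → i + (fibBlock n).length ∈ Q →
      IsBlock v (i + (fibBlock n).length) (fibBlock n) →
      i + (fibBlock n).length + (fibBlock n).length ∈ Q → False) :
    ∃ Q' : Set ℕ, Q'.Nonempty ∧ Parses v (n + 1) Q' := by
  have next : ∀ i ∈ Q, IsBlock v i (fibBlock n) → i + (fibBlock n).length ∈ Q →
      IsBlock v (i + (fibBlock n).length) (fibBlock (n + 1)) ∧
        i + (fibBlock n).length + (fibBlock (n + 1)).length ∈ Q := by
    intro i hi h1 h2
    rcases h _ h2 with ⟨h3, h4⟩ | h3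
    · exact (hsq i hi h1 h2 h3 h4).elim
    · exact h3
  refine ⟨{i | i ∈ Q ∧ IsBlock v i (fibBlock (n + 1)) ∧ i + (fibBlock (n + 1)).length ∈ Q}, ?_, ?_⟩
  · obtain ⟨i, hi⟩ := hQ
    rcases h i hi with ⟨h1, h2⟩ | h1
    · exact ⟨_, h2, next i hi h1 h2⟩
    · exact ⟨i, hi, h1⟩
  · rintro i ⟨hi, h1, h2⟩
    rcases h _ h2 with ⟨h3, h4⟩ | h3
    · refine .inr ⟨?_, ?_⟩
      · rw [fibBlock]
        exact isBlock_append.2 ⟨h1, h3⟩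
      · rw [fibBlock, List.length_append, ← add_assoc]
        exact ⟨h4, next _ h2 h3 h4⟩
    · exact .inl ⟨h1, h2, h3⟩

section

variable {γ : ℝ} {v : ℕ → Bool}

/-- A square of the shorter block extends to a repetition of exponent about `4`. -/
theorem Parses.no_square {n : ℕ} {Q : Set ℕ} (h : Parses v (n + 1) Q) (hγ : γ ≤ 11 / 3)
    (hrep : ∀ i p r : ℕ, 1 ≤ p → Match false v i p r → (2 * p + 2 * r + 1 : ℝ) < γ * (2 * p))
    {i : ℕ} (h1 : IsBlock v i (fibBlock (n + 1)))
    (h2 : IsBlock v (i + (fibBlock (n + 1)).length) (fibBlock (n + 1)))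
    (h3 : i + (fibBlock (n + 1)).length + (fibBlock (n + 1)).length ∈ Q) : False := by
  have h4 := h.isBlock_fibPrefix h3
  rw [fibPrefix] at h4
  have h5 := isBlock_append.2 ⟨h2, h4⟩
  have h6 := isBlock_append.2 ⟨h1, h5⟩
  have h7 : IsBlock v (i + (fibBlock (n + 1)).length)
      (fibBlock (n + 1) ++ (fibBlock (n + 1) ++ fibPrefix (n + 1))) := h5
  have hm := match_of_isBlock h6 h7 (by
    rw [List.prefix_append_right_inj, List.prefix_append_right_inj]
    exact fibPrefix_prefix_append n)
  have hlt := hrep _ _ _ (by rw [length_fibBlock]; exact Nat.fib_pos.2 (by omega)) hm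
  have e1 : (fibPrefix (n + 1)).length + 2 = Nat.fib (n + 2) + Nat.fib (n + 3) := by
    rw [length_fibPrefix]
    exact Nat.fib_add_two
  have e2 : 1 ≤ Nat.fib (n + 2) := Nat.fib_pos.2 (by omega)
  have e3 : 2 ≤ Nat.fib (n + 3) := Nat.fib_mono (show 3 ≤ n + 3 by omega)
  rw [List.length_append, List.length_append, length_fibBlock,
    show n + 1 + 2 = n + 3 from rfl] at hlt
  push_cast at hlt
  have e1' : ((fibPrefix (n + 1)).length + 2 : ℝ) = Nat.fib (n + 2) + Nat.fib (n + 3) := by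
    exact_mod_cast e1
  have e2' : (1 : ℝ) ≤ Nat.fib (n + 2) := by exact_mod_cast e2
  have e3' : (2 : ℝ) ≤ Nat.fib (n + 3) := by exact_mod_cast e3
  nlinarith

theorem exists_parses (hγ : γ ≤ 11 / 3)
    (hrep : ∀ i p r : ℕ, 1 ≤ p → Match false v i p r → (2 * p + 2 * r + 1 : ℝ) < γ * (2 * p))
    (h0 : ∀ i, v i = true ∨ v (i + 1) = true)
    (h1 : ∀ i, ¬ (v i = true ∧ v (i + 1) = true ∧ v (i + 2) = true)) (n : ℕ) :
    ∃ Q : Set ℕ, Q.Nonempty ∧ Parses v n Q := by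
  induction n with
  | zero =>
    refine ⟨{i | v i = true}, ?_, fun i hi => ?_⟩
    · rcases h0 0 with h | h
      exacts [⟨0, h⟩, ⟨1, h⟩]
    · cases h : v (i + 1)
      · refine .inr ⟨?_, ?_⟩
        · exact isBlock_cons.2 ⟨hi, isBlock_cons.2 ⟨h, isBlock_nil _ _⟩⟩
        · have := h0 (i + 1)
          rw [h] at this
          exact this.resolve_left (by decide)
      · exact .inl ⟨isBlock_cons.2 ⟨hi, isBlock_nil _ _⟩, h⟩
  | succ n ih =>
    obtain ⟨Q, hQ, h⟩ := ih
    refine h.succ hQ fun i hi h2 h3 h4 h5 => ?_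
    cases n with
    | zero => exact h1 i ⟨h2 0 true rfl, h4 0 true rfl, (h.isBlock h5) 0 true rfl⟩
    | succ n => exact h.no_square hγ hrep h2 h4 h5

/-- A parsing into the blocks `fibBlock (n + 1)` and `fibBlock (n + 2)` contains the shorter one,
since no block may be repeated four times; it is then the start of a repetition of exponent close
to `2 + φ`. -/
theorem Parses.lt {n : ℕ} {Q : Set ℕ} (h : Parses v (n + 1) Q) (hQ : Q.Nonempty)
    (hγ : γ ≤ 11 / 3)
    (hrep : ∀ i p r : ℕ, 1 ≤ p → Match false v i p r → (2 * p + 2 * r + 1 : ℝ) < γ * (2 * p)) :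
    (4 * Nat.fib (n + 3) + 2 * Nat.fib (n + 4) - 3 : ℝ) < γ * (2 * Nat.fib (n + 3)) := by
  by_cases hS : ∃ i ∈ Q, IsBlock v i (fibBlock (n + 1)) ∧ i + (fibBlock (n + 1)).length ∈ Q
  · obtain ⟨i, -, h1, h2⟩ := hS
    have h3 := h.isBlock_fibPrefix h2
    rw [fibPrefix] at h3
    have hm := match_of_isBlock (isBlock_append.2 ⟨h1, h3⟩) h3 (by
      rw [List.prefix_append_right_inj]
      exact fibPrefix_prefix_append n)
    have hlt := hrep _ _ _ (by rw [length_fibBlock]; exact Nat.fib_pos.2 (by omega)) hm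
    rw [List.length_append, length_fibBlock, show n + 1 + 2 = n + 3 from rfl] at hlt
    have e : ((fibPrefix (n + 1)).length + 2 : ℝ) = Nat.fib (n + 4) := by
      exact_mod_cast length_fibPrefix (n + 1)
    push_cast at hlt
    linarith
  · exfalso
    have all : ∀ i ∈ Q, IsBlock v i (fibBlock (n + 2)) ∧ i + (fibBlock (n + 2)).length ∈ Q := by
      intro i hi
      exact (h i hi).resolve_left fun h1 => hS ⟨i, hi, h1⟩
    obtain ⟨i, hi⟩ := hQ
    obtain ⟨b1, hi⟩ := all i hi
    obtain ⟨b2, hi⟩ := all _ hi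
    obtain ⟨b3, hi⟩ := all _ hi
    obtain ⟨b4, -⟩ := all _ hi
    have h3 := isBlock_append.2 ⟨b2, isBlock_append.2 ⟨b3, b4⟩⟩
    have hm := match_of_isBlock (isBlock_append.2 ⟨b1, h3⟩) h3 (by
      rw [List.prefix_append_right_inj, List.prefix_append_right_inj]
      exact List.prefix_append _ _)
    have hpos : 1 ≤ (fibBlock (n + 2)).length := by
      rw [length_fibBlock]
      exact Nat.fib_pos.2 (by omega)
    have hlt := hrep _ _ _ hpos hm
    have hpos' : (1 : ℝ) ≤ (fibBlock (n + 2)).length := by exact_mod_cast hpos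
    rw [List.length_append, List.length_append] at hlt
    push_cast at hlt
    nlinarith

end

/-- Words with no antisquare of order at least `2` have critical exponent at least `2 + φ`. -/
theorem not_isFree_of_lt {γ : ℝ} (hγ : γ < 2 + Real.goldenRatio) {w : ℕ → Bool} (hl : w ∈ AO 2) :
    ¬ IsFree γ w := by
  intro hw
  have hb := invPhi_bounds
  have hγ' : γ ≤ 11 / 3 := by
    rw [invPhi] at hb
    linarith
  obtain ⟨s, c, hc⟩ := exists_alternate_constant hw hl hγ'
  -- The letters at the other positions; `true` marks those that differ from `c`.
  set v : ℕ → Bool := fun j => w (s + 2 * j + 1) ^^ c with hv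
  have hw' : ∀ j, w (s + 2 * j + 1) = (v j ^^ c) := by
    intro j
    simp [hv]
  have hrep : ∀ i p r : ℕ, 1 ≤ p → Match false v i p r →
      (2 * p + 2 * r + 1 : ℝ) < γ * (2 * p) := by
    intro i p r hp h
    rw [match_false_iff] at h
    have hm : Match false w (s + 2 * i) (2 * p) (2 * r + 1) := by
      rw [match_false_iff]
      intro j hj
      obtain ⟨k, rfl | rfl⟩ : ∃ k, j = 2 * k ∨ j = 2 * k + 1 := ⟨j / 2, by omega⟩
      · rw [show s + 2 * i + 2 * k + 2 * p = s + 2 * (i + k + p) by ring,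
          show s + 2 * i + 2 * k = s + 2 * (i + k) by ring, hc, hc]
      · rw [show s + 2 * i + (2 * k + 1) + 2 * p = s + 2 * (i + k + p) + 1 by ring,
          show s + 2 * i + (2 * k + 1) = s + 2 * (i + k) + 1 by ring, hw', hw', h k (by omega)]
    have := hw.lt_of_match (by omega) hm
    push_cast at this
    linarith
  have h0 : ∀ i, v i = true ∨ v (i + 1) = true := by
    intro i
    by_contra! h
    simp only [Bool.not_eq_true] at h
    have h1 := hw' i
    have h2 := hw' (i + 1)
    rw [h.1, Bool.false_xor] at h1
    rw [h.2, Bool.false_xor] at h2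
    have h3 := hc i
    have h4 := hc (i + 1)
    have h5 := hc (i + 2)
    have hm : Match false w (s + 2 * i) 1 4 := by
      rw [match_false_iff]
      intro j hj
      interval_cases j
      · rw [add_zero, h3, h1]
      · rw [h1]
        exact h4.symm
      · exact h4.trans h2.symm
      · exact h2.trans h5.symm
    have := hw.lt_of_match le_rfl hm
    push_cast at this
    linarith
  have h1 : ∀ i, ¬ (v i = true ∧ v (i + 1) = true ∧ v (i + 2) = true) := by
    rintro i ⟨h1, h2, h3⟩
    have e1 := hw' i
    have e2 := hw' (i + 1)
    have e3 := hw' (i + 2)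
    rw [h1, Bool.true_xor] at e1
    rw [h2, Bool.true_xor] at e2
    rw [h3, Bool.true_xor] at e3
    refine mem_AO_iff.1 hl 3 (by norm_num) (by norm_num) (s + 2 * i) (match_true_iff.2 ?_)
    intro j hj
    interval_cases j
    · rw [add_zero, hc]
      exact e2
    · rw [e1, Bool.not_not]
      exact hc (i + 2)
    · exact e3.trans (congrArg not (hc (i + 1)).symm)
  -- The exponents found at level `n` tend to `2 + φ`.
  obtain ⟨m, hm⟩ := exists_nat_gt (5 / (4 + 2 * Real.goldenRatio - 2 * γ))
  obtain ⟨Q, hQ, h⟩ := exists_parses hγ' hrep h0 h1 (m + 6 + 1)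
  have hlt := h.lt hQ hγ' hrep
  have hpos : 0 < 4 + 2 * Real.goldenRatio - 2 * γ := by linarith
  rw [div_lt_iff₀ hpos] at hm
  have h2 := Real.fib_succ_sub_goldenRatio_mul_fib (m + 6 + 3)
  have h3 : -1 ≤ Real.goldenConj ^ (m + 6 + 3) := by
    refine (neg_le_neg ?_).trans (neg_abs_le _)
    rw [abs_pow, goldenConj_eq, abs_neg, abs_of_pos invPhi_pos]
    exact pow_le_one₀ (by linarith) (by linarith)
  have h4 : (m : ℝ) ≤ Nat.fib (m + 6 + 3) := by
    exact_mod_cast (Nat.le_fib_self (n := m + 6 + 3) (by omega)).trans' (by omega)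
  rw [show m + 6 + 3 + 1 = m + 6 + 4 from rfl] at h2
  nlinarith

/-! ### The four pairs -/

theorem golden_le_criticalExponent {w : ℕ → Bool} (hw : w ∈ AO 2) :
    ((2 + Real.goldenRatio : ℝ) : EReal) ≤ criticalExponent w := by
  by_contra! h
  obtain ⟨γ, h1, h2⟩ := EReal.lt_iff_exists_real_btwn.1 h
  exact not_isFree_of_lt (EReal.coe_lt_coe_iff.1 h2) hw (isFree_of_criticalExponent_lt h1)

theorem theorem9 :
    -- for each of the four pairs: existence, optimality of `β` for `l`, optimality of `l` for `β`
    (∀ p ∈ ({(2, 2 + Real.goldenRatio), (3, 8 / 3), (5, 5 / 2), (6, 7 / 3)} : Set (ℕ × ℝ)),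
      (∃ w ∈ AO p.1, IsPlusFree p.2 w) ∧
      (∀ w ∈ AO p.1, (p.2 : EReal) ≤ criticalExponent w) ∧
      (∀ l : ℕ, l < p.1 → ¬ ∃ w ∈ AO l, IsPlusFree p.2 w)) ∧
    -- for the three rational values, not even `β`-freeness is possible
    (∀ p ∈ ({(3, 8 / 3), (5, 5 / 2), (6, 7 / 3)} : Set (ℕ × ℝ)),
      ¬ ∃ w ∈ AO p.1, IsFree p.2 w) := by
  constructor
  · rintro p (rfl | rfl | rfl | rfl)
    · refine ⟨⟨_, paddedFibWord_mem_AO, paddedFibWord_isPlusFree⟩,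
        fun w hw => golden_le_criticalExponent hw, ?_⟩
      rintro l hl ⟨w, hw, h⟩
      exact not_isPlusFree_two_add_goldenRatio (AO_mono (Nat.le_of_lt_succ hl) hw) h
    · refine ⟨⟨_, isGoodMorphism_threeMorphism.mem_AO,
        isGoodMorphism_threeMorphism.isPlusFree (by norm_num)⟩,
        fun w hw => le_criticalExponent_of_not_isFree (not_isFree_eight_thirds hw), ?_⟩
      rintro l hl ⟨w, hw, h⟩
      exact not_isPlusFree_eight_thirds (AO_mono (Nat.le_of_lt_succ hl) hw) h
    · refine ⟨⟨_, isGoodMorphism_fiveMorphism.mem_AO,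
        isGoodMorphism_fiveMorphism.isPlusFree (by norm_num)⟩,
        fun w hw => le_criticalExponent_of_not_isFree (not_isFree_five_halves hw), ?_⟩
      rintro l hl ⟨w, hw, h⟩
      exact not_isPlusFree_five_halves (AO_mono (Nat.le_of_lt_succ hl) hw) h
    · refine ⟨⟨_, isGoodMorphism_sixMorphism.mem_AO,
        isGoodMorphism_sixMorphism.isPlusFree (by norm_num)⟩,
        fun w hw => le_criticalExponent_of_not_isFree (not_isFree_seven_thirds hw), ?_⟩
      rintro l hl ⟨w, hw, h⟩
      exact not_isPlusFree_seven_thirds (AO_mono (Nat.le_of_lt_succ hl) hw) h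
  · rintro p (rfl | rfl | rfl) ⟨w, hw, h⟩
    · exact not_isFree_eight_thirds hw h
    · exact not_isFree_five_halves hw h
    · exact not_isFree_seven_thirds hw h
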